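/- Let $\mathbb K$ be a field, $E$ a finite-dimensional $\mathbb K$-vector space, $R\subset E\otimes E$ a subspace and $\varphi:R\to E$ a linear map. Put $\mathfrak A=T(E)/[\{r-\varphi(r)\mid r\in R\}]$ (the enveloping algebra, augmented by the map $\varepsilon:\mathfrak A\to\mathbb K$ killing $E$), $\mathcal A=T(E)/[R]$ and $\mathcal A^!=T(E^*)/[R^\perp]$, where $R^\perp\subset E^*\otimes E^*=(E\otimes E)^*$ is the annihilator of $R$; thus $\mathcal A^!_1=E^*$ and $\mathcal A^!_2=R^*$. Let $\mathcal A^{!*}$ be the graded dual of $\mathcal A^!$. Assume that $(E,R,\varphi)$ is a Lie prealgebra, that is: (1) $\mathcal A$ is Koszul (the Koszul complex $\mathcal A\otimes\mathcal A^{!*}_\bullet$ is acyclic in positive degrees), has finite global dimension $D$, and is Gorenstein ($\mathrm{Ext}^n_{\mathcal A}(\mathbb K,\mathcal A)=0$ for $n\neq D$ and $\mathrm{Ext}^D_{\mathcal A}(\mathbb K,\mathcal A)\simeq\mathbb K$); (2) $\mathfrak A$ has the PBW property: the canonical surjection $\mathcal A\to\mathrm{gr}(\mathfrak A)$ is an isomorphism.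 Then there is a unique antiderivation $\delta$ of degree $1$ of $\mathcal A^!$ which extends $-\varphi^t:\mathcal A^!_1=E^*\to R^*=\mathcal A^!_2$, and $\delta^2=0$. Let $(x^\lambda)$ be a basis of $E$ with dual basis $(\omega_\lambda)$ of $E^*$. Then the following hold. (a) For every left $\mathfrak A$-module $V$, the operator $$\delta_V(\Phi\otimes\alpha)=\sum_\lambda x^\lambda\Phi\otimes\omega_\lambda\alpha+\Phi\otimes\delta\alpha$$ on $V\otimes\mathcal A^!$ is of degree $1$ and satisfies $\delta_V^2=0$. For every $n\ge 0$ there are $\mathbb K$-linear isomorphisms, natural in $V$, $$H^n(V\otimes\mathcal A^!,\delta_V)\simeq\mathrm{Ext}^n_{\mathfrak A}(\mathbb K,V).$$ (b) For every right $\mathfrak A$-module $W$, the operator $$\delta_W(w\otimes\xi)=\sum_\lambda wx^\lambda\otimes\xi(\omega_\lambda\,\cdot\,)+w\otimes\xi\circ\delta$$ on $W\otimes\mathcal A^{!*}$ is of degree $-1$ and satisfies $\delta_W^2=0$. For every $n\ge0$ there are $\mathbb K$-linear isomorphisms, natural in $W$, $$H_n(W\otimes\mathcal A^{!*},\delta_W)\simeq\mathrm{Tor}_n^{\mathfrak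 A}(W,\mathbb K).$$ Here $\mathbb K$ is the trivial left module given by the augmentation. -/

import Mathlib

open CategoryTheory TensorProduct

universe u

noncomputable section

/-! ### Algebras presented by generators and relations -/

namespace Presented

variable {K E : Type u} [Field K] [AddCommGroup E] [Module K E]

/-- The canonical embedding `E ⊗ E → T(E)`, `x ⊗ y ↦ x y`, onto the tensors of degree two. -/
def sq : E ⊗[K] E →ₗ[K] TensorAlgebra K E :=
  TensorProduct.lift
    ((LinearMap.mul K (TensorAlgebra K E)).compl₁₂ (TensorAlgebra.ι K) (TensorAlgebra.ι K))

/-- `T(E) / [S]`, the quotient of the tensor algebra by the two-sided ideal generated by `S`. -/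
abbrev Alg (S : Set (TensorAlgebra K E)) : Type u :=
  RingQuot (fun a b : TensorAlgebra K E => a ∈ S ∧ b = 0)

/-- The canonical projection `T(E) → T(E) / [S]`. -/
def proj (S : Set (TensorAlgebra K E)) : TensorAlgebra K E →ₐ[K] Alg S :=
  RingQuot.mkAlgHom K _

/-- The canonical linear map `E → T(E) / [S]`. -/
def gen (S : Set (TensorAlgebra K E)) : E →ₗ[K] Alg S :=
  (proj S).toLinearMap ∘ₗ TensorAlgebra.ι K

/-- The image in `T(E) / [S]` of the tensors of degree `n`. When `S` is homogeneous this is the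
component of degree `n` of the graded algebra `T(E) / [S]`. -/
def degPart (S : Set (TensorAlgebra K E)) (n : ℕ) : Submodule K (Alg S) :=
  ((LinearMap.range (TensorAlgebra.ι K : E →ₗ[K] TensorAlgebra K E)) ^ n).map (proj S).toLinearMap

/-- The part of filtration degree `< n` of `T(E) / [S]`, i.e. the image of the tensors of degree
`< n`. -/
def filtLT (S : Set (TensorAlgebra K E)) (n : ℕ) : Submodule K (Alg S) :=
  ⨆ (m : ℕ) (_ : m < n), degPart S m

/-- The augmentation `T(E) / [S] → K` induced by the projection of `T(E)` onto tensors of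
degree zero. -/
def aug (S : Set (TensorAlgebra K E))
    (hS : ∀ s ∈ S, TensorAlgebra.algebraMapInv (R := K) (M := E) s = 0) : Alg S →ₐ[K] K :=
  RingQuot.liftAlgHom K ⟨TensorAlgebra.algebraMapInv, by
    rintro a b ⟨ha, rfl⟩
    rw [hS a ha, map_zero]⟩

theorem algebraMapInv_sq (t : E ⊗[K] E) :
    TensorAlgebra.algebraMapInv (R := K) (M := E) (sq t) = 0 := by
  induction t using TensorProduct.induction_on with
  | zero => simp
  | tmul x y => simp [sq, TensorAlgebra.algebraMapInv]
  | add x y hx hy => rw [map_add, map_add, hx, hy, add_zero]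

end Presented

/-! ### Ext and Tor with the trivial module

`Ext` is Mathlib's. Mathlib has no tensor product over a noncommutative ring, hence no `Tor` over
one, so both are built here. -/

namespace AugAlg

variable {K A : Type u} [Field K] [Ring A] [Algebra K A]

/-- The trivial left `A`-module `K` of an augmented algebra `ε : A → K`. -/
def triv (ε : A →ₐ[K] K) : ModuleCat.{u} A :=
  (ModuleCat.restrictScalars ε.toRingHom).obj (ModuleCat.of K K)

variable (A)
variable (W : Type u) [AddCommGroup W] [Module K W] [Module Aᵐᵒᵖ W] [IsScalarTower K Aᵐᵒᵖ W]
variable (W' : Type u) [AddCommGroup W'] [Module K W'] [Module Aᵐᵒᵖ W'] [IsScalarTower K Aᵐᵒᵖ W']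

variable (K) in
/-- The span of the elements `w a ⊗ m - w ⊗ a m` of `W ⊗ M`, where `W` is a right `A`-module and
`M` a left `A`-module. -/
def balanced (M : Type u) [AddCommGroup M] [Module A M] : Submodule K (W ⊗[ℤ] M) :=
  Submodule.span K
    {z | ∃ (w : W) (a : A) (m : M), z = (MulOpposite.op a • w) ⊗ₜ[ℤ] m - w ⊗ₜ[ℤ] (a • m)}

variable {A W W'} in
/-- `g ⊗ f : W ⊗ M → W' ⊗ N` respects the relations of `balanced`. -/
theorem balanced_le_comap {M N : Type u} [AddCommGroup M] [Module A M] [AddCommGroup N]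
    [Module A N] (g : W →ₗ[Aᵐᵒᵖ] W') (f : M →ₗ[A] N) :
    balanced K A W M ≤ (balanced K A W' N).comap
      (TensorProduct.AlgebraTensorModule.map (g.restrictScalars K) (f.restrictScalars ℤ)) := by
  refine Submodule.span_le.2 ?_
  rintro _ ⟨w, a, m, rfl⟩
  refine Submodule.subset_span ⟨g w, a, f m, ?_⟩
  simp

variable {A W W'} in
/-- The map `g ⊗ f : W ⊗_A M → W' ⊗_A N`. -/
def balancedMap {M N : Type u} [AddCommGroup M] [Module A M] [AddCommGroup N]
    [Module A N] (g : W →ₗ[Aᵐᵒᵖ] W') (f : M →ₗ[A] N) :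
    ((W ⊗[ℤ] M) ⧸ balanced K A W M) →ₗ[K] ((W' ⊗[ℤ] N) ⧸ balanced K A W' N) :=
  Submodule.mapQ _ _ _ (balanced_le_comap g f)

variable {A W W'} in
theorem balanced_hom_ext {M X : Type u} [AddCommGroup M] [Module A M] [AddCommGroup X] [Module K X]
    {p q : ((W ⊗[ℤ] M) ⧸ balanced K A W M) →ₗ[K] X}
    (h : ∀ (w : W) (m : M), p (Submodule.Quotient.mk (w ⊗ₜ m)) =
      q (Submodule.Quotient.mk (w ⊗ₜ m))) : p = q := by
  refine LinearMap.ext fun x => ?_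
  obtain ⟨x, rfl⟩ := Submodule.Quotient.mk_surjective _ x
  induction x using TensorProduct.induction_on with
  | zero => simp
  | tmul w m => exact h w m
  | add x y hx hy => rw [Submodule.Quotient.mk_add, map_add, map_add, hx, hy]

variable (K) in
/-- The functor `M ↦ W ⊗_A M` from left `A`-modules to `K`-vector spaces. -/
def tensorFunctor : ModuleCat.{u} A ⥤ ModuleCat.{u} K where
  obj M := ModuleCat.of K ((W ⊗[ℤ] M) ⧸ balanced K A W M)
  map f := ModuleCat.ofHom (balancedMap LinearMap.id f.hom)
  map_id M := by
    refine ModuleCat.hom_ext (balanced_hom_ext fun w m => ?_)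
    simp [balancedMap]
  map_comp f g := by
    refine ModuleCat.hom_ext (balanced_hom_ext fun w m => ?_)
    simp [balancedMap]

instance : (tensorFunctor K A W).Additive where
  map_add {M N f g} := by
    refine ModuleCat.hom_ext (balanced_hom_ext fun w m => ?_)
    exact congrArg Submodule.Quotient.mk (TensorProduct.tmul_add w (f.hom m) (g.hom m))

variable {A W W'} in
/-- A morphism `W → W'` of right modules induces a morphism of functors. -/
def tensorNat (g : W →ₗ[Aᵐᵒᵖ] W') : tensorFunctor K A W ⟶ tensorFunctor K A W' where
  app M := ModuleCat.ofHom (balancedMap g LinearMap.id)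
  naturality M N f := by
    refine ModuleCat.hom_ext (balanced_hom_ext fun w m => ?_)
    rfl

variable {A} in
/-- `Tor^A_n(W, K)` for a right module `W` over the augmented algebra `ε : A → K`: the value at
the trivial module of the `n`-th left derived functor of `W ⊗_A -`. -/
abbrev Tor (ε : A →ₐ[K] K) (n : ℕ) : ModuleCat.{u} K :=
  ((tensorFunctor K A W).leftDerived n).obj (triv ε)

variable {A W W'} in
/-- `Tor^A_n(g, K) : Tor^A_n(W, K) → Tor^A_n(W', K)`. -/
def Tor.map (ε : A →ₐ[K] K) (n : ℕ) (g : W →ₗ[Aᵐᵒᵖ] W') : Tor W ε n →ₗ[K] Tor W' ε n :=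
  ((NatTrans.leftDerived (tensorNat g) n).app (triv ε)).hom

end AugAlg

/-! ### (Co)homology of a graded vector space with an endomorphism -/

section Homology

variable {K M : Type u} [Field K] [AddCommGroup M] [Module K M]

/-- The cycles of `d` in the homogeneous component `P`. -/
def cycles (d : M →ₗ[K] M) (P : Submodule K M) : Submodule K M := P ⊓ LinearMap.ker d

/-- The (co)homology of `d` at the homogeneous component `P`, where `Q` is the component which `d`
maps into `P`: cycles in `P` modulo the image of `Q`. -/
abbrev Homol (d : M →ₗ[K] M) (P Q : Submodule K M) : Type u :=
  ↥(cycles d P) ⧸ (Q.map d).submoduleOf (cycles d P)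

/-- The class of a cycle. -/
def Homol.cls (d : M →ₗ[K] M) (P Q : Submodule K M) : ↥(cycles d P) →ₗ[K] Homol d P Q :=
  Submodule.mkQ _

end Homology

/-! ### Prealgebras -/

/-- A prealgebra structure on `E`: a subspace `R ⊆ E ⊗ E` with a linear map `φ : R → E`. -/
structure Prealgebra (K E : Type u) [Field K] [AddCommGroup E] [Module K E] where
  R : Submodule K (E ⊗[K] E)
  φ : R →ₗ[K] E

namespace Prealgebra

open Presented AugAlg

variable {K E : Type u} [Field K] [AddCommGroup E] [Module K E] (L : Prealgebra K E)

/-- The relations `r - φ(r)`, `r ∈ R`. -/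
def envRel : Set (TensorAlgebra K E) :=
  Set.range fun r : L.R => sq (r : E ⊗[K] E) - TensorAlgebra.ι K (L.φ r)

/-- The relations `r`, `r ∈ R`. -/
def quadRel : Set (TensorAlgebra K E) := sq '' (L.R : Set (E ⊗[K] E))

/-- `R^⊥ ⊆ E^* ⊗ E^*`, the tensors which vanish on `R` when seen as linear forms on `E ⊗ E`. -/
def perp : Submodule K (Module.Dual K E ⊗[K] Module.Dual K E) :=
  L.R.dualAnnihilator.comap (TensorProduct.dualDistrib K E E)

/-- The relations of the Koszul dual. -/
def dualRel : Set (TensorAlgebra K (Module.Dual K E)) :=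
  sq '' (L.perp : Set (Module.Dual K E ⊗[K] Module.Dual K E))

/-- The enveloping algebra `T(E) / [{r - φ(r)}]`. -/
abbrev Env : Type u := Alg L.envRel

/-- The quadratic part `T(E) / [R]` of the enveloping algebra. -/
abbrev Quad : Type u := Alg L.quadRel

/-- The Koszul dual `T(E^*) / [R^⊥]` of the quadratic part. -/
abbrev KDual : Type u := Alg L.dualRel

/-- The augmentation of the enveloping algebra. -/
def envAug : L.Env →ₐ[K] K := aug L.envRel (by
  rintro _ ⟨r, rfl⟩
  rw [map_sub, algebraMapInv_sq]
  simp [TensorAlgebra.algebraMapInv])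

/-- The augmentation of the quadratic part. -/
def quadAug : L.Quad →ₐ[K] K := aug L.quadRel (by
  rintro _ ⟨r, -, rfl⟩
  exact algebraMapInv_sq r)

/-- The trivial left module over the enveloping algebra. -/
abbrev envTriv : ModuleCat.{u} L.Env := triv L.envAug

/-- The trivial left module over the quadratic part. -/
abbrev quadTriv : ModuleCat.{u} L.Quad := triv L.quadAug

/-- The component of degree `n` of the graded dual of the Koszul dual: linear forms which vanish on
all the components of degree `m ≠ n`. -/
def codualPart (n : ℕ) : Submodule K (Module.Dual K L.KDual) :=
  ⨅ (m : ℕ) (_ : m ≠ n), (degPart L.dualRel m).dualAnnihilator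

/-- `M ⊗ 𝒜^!_n` as a subspace of `M ⊗ 𝒜^!`. -/
def cochains (M : Type u) [AddCommGroup M] [Module K M] (n : ℕ) :
    Submodule K (M ⊗[K] L.KDual) :=
  LinearMap.range ((degPart L.dualRel n).subtype.lTensor M)

/-- `M ⊗ (𝒜^!_n)^*` as a subspace of `M ⊗ (𝒜^!)^*`. -/
def chains (M : Type u) [AddCommGroup M] [Module K M] (n : ℕ) :
    Submodule K (M ⊗[K] Module.Dual K L.KDual) :=
  LinearMap.range ((L.codualPart n).subtype.lTensor M)

/-- Left multiplication by the element `ω ∈ E^*` on the Koszul dual. -/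
def mulGen (ω : Module.Dual K E) : L.KDual →ₗ[K] L.KDual :=
  LinearMap.mulLeft K (gen L.dualRel ω)

section Operators

variable {ι : Type*} [Fintype ι] (b : Module.Basis ι K E)

/-- For linear operators `ρ(x)` on `M`, `x ∈ E`, the operator
`m ⊗ ξ ↦ ∑ ρ(x^λ) m ⊗ ξ(ω_λ ·)` on `M ⊗ (𝒜^!)^*`, where `(x^λ)` is a basis of `E` with dual basis
`(ω_λ)`. Under the identification of `(𝒜^!_n)^*` with a subspace of `E^{⊗ n}` this is
`m ⊗ (e₀ ⊗ e₁ ⊗ ⋯) ↦ ρ(e₀) m ⊗ (e₁ ⊗ ⋯)`. -/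
def contract {M : Type u} [AddCommGroup M] [Module K M] (ρ : E → Module.End K M) :
    M ⊗[K] Module.Dual K L.KDual →ₗ[K] M ⊗[K] Module.Dual K L.KDual :=
  ∑ i, TensorProduct.map (ρ (b i)) (L.mulGen (b.coord i)).dualMap

/-- For a left representation `V`, the operator
`δ_V (Φ ⊗ α) = ∑ x^λ Φ ⊗ ω_λ α + Φ ⊗ δ α` on `V ⊗ 𝒜^!`. -/
def cochainD (δ : L.KDual →ₗ[K] L.KDual) (V : Type u) [AddCommGroup V] [Module K V]
    [Module L.Env V] [IsScalarTower K L.Env V] : V ⊗[K] L.KDual →ₗ[K] V ⊗[K] L.KDual :=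
  ∑ i, TensorProduct.map (Algebra.lsmul K K V (gen L.envRel (b i))) (L.mulGen (b.coord i))
    + δ.lTensor V

/-- For a right representation `W`, the operator
`δ_W (w ⊗ ξ) = ∑ w x^λ ⊗ ξ(ω_λ ·) + w ⊗ ξ(δ ·)` on `W ⊗ (𝒜^!)^*`. -/
def chainD (δ : L.KDual →ₗ[K] L.KDual) (W : Type u) [AddCommGroup W] [Module K W]
    [Module L.Envᵐᵒᵖ W] [IsScalarTower K L.Envᵐᵒᵖ W] :
    W ⊗[K] Module.Dual K L.KDual →ₗ[K] W ⊗[K] Module.Dual K L.KDual :=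
  L.contract b (fun x => Algebra.lsmul K K W (MulOpposite.op (gen L.envRel x)))
    + δ.dualMap.lTensor W

/-- The `n`-th cohomology space `H^n(V ⊗ 𝒜^!)`. -/
abbrev Cohom (δ : L.KDual →ₗ[K] L.KDual) (V : Type u) [AddCommGroup V] [Module K V]
    [Module L.Env V] [IsScalarTower K L.Env V] (n : ℕ) : Type u :=
  Homol (L.cochainD b δ V) (L.cochains V n) (⨆ (m : ℕ) (_ : m + 1 = n), L.cochains V m)

/-- The class in `H^n(V ⊗ 𝒜^!)` of a cocycle. -/
def Cohom.cls (δ : L.KDual →ₗ[K] L.KDual) (V : Type u) [AddCommGroup V] [Module K V]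
    [Module L.Env V] [IsScalarTower K L.Env V] (n : ℕ) :
    ↥(cycles (L.cochainD b δ V) (L.cochains V n)) →ₗ[K] L.Cohom b δ V n :=
  Homol.cls _ _ _

/-- The `n`-th homology space `H_n(W ⊗ (𝒜^!)^*)`. -/
abbrev Homlg (δ : L.KDual →ₗ[K] L.KDual) (W : Type u) [AddCommGroup W] [Module K W]
    [Module L.Envᵐᵒᵖ W] [IsScalarTower K L.Envᵐᵒᵖ W] (n : ℕ) : Type u :=
  Homol (L.chainD b δ W) (L.chains W n) (L.chains W (n + 1))

/-- The class in `H_n(W ⊗ (𝒜^!)^*)` of a cycle. -/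
def Homlg.cls (δ : L.KDual →ₗ[K] L.KDual) (W : Type u) [AddCommGroup W] [Module K W]
    [Module L.Envᵐᵒᵖ W] [IsScalarTower K L.Envᵐᵒᵖ W] (n : ℕ) :
    ↥(cycles (L.chainD b δ W) (L.chains W n)) →ₗ[K] L.Homlg b δ W n :=
  Homol.cls _ _ _

end Operators

/-! ### Lie prealgebras -/

/-- The differential `d (a ⊗ (e₀ ⊗ e₁ ⊗ ⋯)) = a e₀ ⊗ (e₁ ⊗ ⋯)` of the Koszul complex
`𝒜 ⊗ (𝒜^!)^*` of the quadratic part. -/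
def koszulD [FiniteDimensional K E] :
    L.Quad ⊗[K] Module.Dual K L.KDual →ₗ[K] L.Quad ⊗[K] Module.Dual K L.KDual :=
  L.contract (Module.finBasis K E) (fun x => LinearMap.mulRight K (gen L.quadRel x))

/-- The quadratic part is Koszul: its Koszul complex is acyclic in positive degrees. -/
def IsKoszul [FiniteDimensional K E] : Prop :=
  ∀ n : ℕ, Subsingleton
    (Homol L.koszulD (L.chains L.Quad (n + 1)) (L.chains L.Quad (n + 2)))

/-- The quadratic part has finite global dimension `D` (for a connected graded algebra this is the
projective dimension of the trivial module) and is Gorenstein: `Ext^n(K, 𝒜)` vanishes for `n ≠ D`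
and is `K` for `n = D`. -/
def IsGorenstein : Prop :=
  ∃ D : ℕ, projectiveDimension L.quadTriv = D ∧
    (∀ n : ℕ, n ≠ D → Subsingleton (Abelian.Ext L.quadTriv (ModuleCat.of L.Quad L.Quad) n)) ∧
    Module.finrank K (Abelian.Ext L.quadTriv (ModuleCat.of L.Quad L.Quad) D) = 1

/-- The Poincaré–Birkhoff–Witt property of the enveloping algebra `𝔄`: the canonical surjection
from the quadratic part to the associated graded algebra, which maps the class of a tensor `t` of
degree `n` to the class of `t` in `F^n(𝔄) / F^{n-1}(𝔄)`, is injective. -/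
def HasPBW : Prop :=
  ∀ (n : ℕ), ∀ t ∈ (LinearMap.range (TensorAlgebra.ι K : E →ₗ[K] TensorAlgebra K E)) ^ n,
    proj L.envRel t ∈ filtLT L.envRel n → proj L.quadRel t = 0

/-- A Lie prealgebra. -/
structure IsLie [FiniteDimensional K E] : Prop where
  koszul : L.IsKoszul
  gorenstein : L.IsGorenstein
  pbw : L.HasPBW

/-- `δ` is an antiderivation of degree one of the Koszul dual which extends minus the transpose of
`φ`. The latter maps `ω ∈ E^* = 𝒜^!_1` to the linear form `-ω ∘ φ` on `R`, and a linear form on `R`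
is seen as an element of `𝒜^!_2 = (E^* ⊗ E^*) / R^⊥` by means of any `t ∈ E^* ⊗ E^*` which
restricts to it. -/
structure IsDualDifferential (δ : L.KDual →ₗ[K] L.KDual) : Prop where
  degree : ∀ n, (degPart L.dualRel n).map δ ≤ degPart L.dualRel (n + 1)
  antiderivation : ∀ n, ∀ α ∈ degPart L.dualRel n, ∀ β,
    δ (α * β) = δ α * β + (-1 : K) ^ n • (α * δ β)
  extends_transpose : ∀ (ω : Module.Dual K E) (t : Module.Dual K E ⊗[K] Module.Dual K E),
    (∀ r : L.R, TensorProduct.dualDistrib K E E t r = -ω (L.φ r)) →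
      δ (gen L.dualRel ω) = proj L.dualRel (sq t)

end Prealgebra

end

/-!
The proof is an explicit resolution of the trivial module. Write `𝔄` for the enveloping algebra,
`𝒜` for its quadratic part and `δ` for the differential of `𝒜^!`.

*The differential.* An antiderivation of `𝒜^!` with values `D(ω)` on the generators is the upper
right entry of an algebra homomorphism `α ↦ ((-1)^{|α|} α, δ α; 0, α)` into two by two matrices,
so it exists as soon as the relations of `𝒜^!` are respected (`sqD_eq_zero`). The obstruction is
dual to the jacobiator `(φ ⊗ 1 - 1 ⊗ φ)(w)`, `w ∈ (R ⊗ E) ∩ (E ⊗ R)`. Since the jacobiator vanishes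
in `𝔄`, the Poincaré–Birkhoff–Witt property in degree two puts it in `R` (`jacobiator_mem`), which
makes `δ` well defined, and the property in degree one then shows that `φ` kills it
(`φ_jacobiator`), which gives `δ² = 0` on generators (`sqD_transpose`).

*The complexes.* The relations `r = φ(r)` of `𝔄` amount to
`∑ x^λ x^μ ⊗ ω_λ ω_μ + ∑ x^λ ⊗ δ ω_λ = 0` in `𝔄 ⊗ 𝒜^!` (`sum_tmul_add_sum_tmul_eq_zero`). This one
identity gives `δ_V² = 0`, `δ_W² = 0`, and the analogous fact for the resolution.

*The resolution.* Its terms are the free left `𝔄`-modules `Hom(𝒜^!_n, 𝔄)`, realized as the linear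
maps `𝒜^! → 𝔄` which vanish in degrees `m ≠ n` (`supported`), with the differential
`f ↦ ∑ f(ω_λ ·) x^λ + f ∘ δ` (`resD`). It is a filtered deformation of the Koszul complex of `𝒜`:
by the Poincaré–Birkhoff–Witt property the leading term of a cycle is a Koszul cycle, hence a Koszul
boundary when the degree is positive, and subtracting a lift of this boundary lowers the filtration
degree (`exists_resD_eq_of_mem_filtLT`). In degree zero exactness only says that the augmentation
ideal is generated by `E` (`exists_resD_eq_zero`).

*Ext and Tor.* The complexes `Hom(Hom(𝒜^!_n, 𝔄), V)` and `W ⊗_𝔄 Hom(𝒜^!_n, 𝔄)` are identified with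
`V ⊗ 𝒜^!` and `W ⊗ (𝒜^!)^*` by `v ⊗ α ↦ (f ↦ f(α) v)` (`cochainMor`) and the inverse of
`w ⊗ f ↦ (α ↦ w f(α))` (`chainToTensor`). These identifications are natural in the coefficients.
-/

noncomputable section

namespace Presented

variable {K E : Type u} [Field K] [AddCommGroup E] [Module K E]

/-! ### Graded structure of algebras with homogeneous relations -/

/-- The tensors of degree `n` in `T(E)`. -/
abbrev tpow (K E : Type u) [Field K] [AddCommGroup E] [Module K E] (n : ℕ) :
    Submodule K (TensorAlgebra K E) :=
  (LinearMap.range (TensorAlgebra.ι K : E →ₗ[K] TensorAlgebra K E)) ^ n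

/-- The projection of `T(E)` onto its component of degree `n`. -/
def tcomp (n : ℕ) : TensorAlgebra K E →ₗ[K] TensorAlgebra K E :=
  GradedAlgebra.proj (tpow K E) n

theorem tcomp_mem (n : ℕ) (t : TensorAlgebra K E) : tcomp n t ∈ tpow K E n :=
  (DirectSum.decompose (tpow K E) t n).2

theorem tcomp_of_mem {n : ℕ} {t : TensorAlgebra K E} (ht : t ∈ tpow K E n) : tcomp n t = t :=
  DirectSum.decompose_of_mem_same (tpow K E) ht

theorem tcomp_of_mem_ne {m n : ℕ} {t : TensorAlgebra K E} (ht : t ∈ tpow K E m) (h : m ≠ n) :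
    tcomp n t = 0 :=
  DirectSum.decompose_of_mem_ne (tpow K E) ht h

theorem ι_mem (x : E) : TensorAlgebra.ι K x ∈ tpow K E 1 := by
  simp [tpow]

theorem sq_mem (s : E ⊗[K] E) : sq s ∈ tpow K E 2 := by
  induction s using TensorProduct.induction_on with
  | zero => simp
  | tmul x y =>
    rw [tpow, pow_two]
    exact Submodule.mul_mem_mul ⟨x, rfl⟩ ⟨y, rfl⟩
  | add x y hx hy => rw [map_add]; exact add_mem hx hy

theorem tcomp_ι_mul_succ (n : ℕ) (x : E) (t : TensorAlgebra K E) :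
    tcomp (n + 1) (TensorAlgebra.ι K x * t) = TensorAlgebra.ι K x * tcomp n t := by
  rw [add_comm]
  exact DirectSum.coe_decompose_mul_add_of_left_mem (tpow K E) (ι_mem x)

theorem tcomp_ι_mul_zero (x : E) (t : TensorAlgebra K E) :
    tcomp 0 (TensorAlgebra.ι K x * t) = 0 :=
  DirectSum.coe_decompose_mul_of_left_mem_of_not_le (tpow K E) (ι_mem x) (by simp)

theorem tcomp_mul_ι_succ (n : ℕ) (x : E) (t : TensorAlgebra K E) :
    tcomp (n + 1) (t * TensorAlgebra.ι K x) = tcomp n t * TensorAlgebra.ι K x :=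
  DirectSum.coe_decompose_mul_add_of_right_mem (tpow K E) (ι_mem x)

theorem tcomp_mul_ι_zero (x : E) (t : TensorAlgebra K E) :
    tcomp 0 (t * TensorAlgebra.ι K x) = 0 :=
  DirectSum.coe_decompose_mul_of_right_mem_of_not_le (tpow K E) (ι_mem x) (by simp)

variable (S : Set (TensorAlgebra K E))

theorem proj_surjective : Function.Surjective (proj S) :=
  RingQuot.mkAlgHom_surjective K _

theorem proj_of_mem {s : TensorAlgebra K E} (hs : s ∈ S) : proj S s = 0 := by
  rw [← map_zero (proj S)]
  exact RingQuot.mkAlgHom_rel K ⟨hs, rfl⟩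

theorem proj_ι (x : E) : proj S (TensorAlgebra.ι K x) = gen S x := rfl

theorem proj_mem_degPart {n : ℕ} {t : TensorAlgebra K E} (ht : t ∈ tpow K E n) :
    proj S t ∈ degPart S n := ⟨t, ht, rfl⟩

variable {S}

/-- A subspace of `T(E)` which contains the relations `S` and is stable under left and right
multiplication by `E` contains the kernel of `T(E) → T(E) / [S]`. -/
theorem mem_of_proj_eq_zero (J : Submodule K (TensorAlgebra K E)) (hS : S ⊆ J)
    (hl : ∀ x, ∀ t ∈ J, TensorAlgebra.ι K x * t ∈ J)
    (hr : ∀ x, ∀ t ∈ J, t * TensorAlgebra.ι K x ∈ J) {t : TensorAlgebra K E}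
    (ht : proj S t = 0) : t ∈ J := by
  -- `T(E)` acts from the left on `T(E) / J`, and this action factors through `T(E) / [S]`.
  let act : E →ₗ[K] Module.End K (TensorAlgebra K E ⧸ J) :=
    { toFun x := J.mapQ J (LinearMap.mulLeft K (TensorAlgebra.ι K x)) (fun t h => hl x t h)
      map_add' x y := by ext t; simp [add_mul]; rfl
      map_smul' c x := by ext t; simp; rfl }
  have key : ∀ t s, TensorAlgebra.lift K act t (Submodule.Quotient.mk s) =
      Submodule.Quotient.mk (t * s) := by
    intro t
    induction t using TensorAlgebra.induction with
    | algebraMap r =>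
      intro s
      rw [AlgHom.commutes, Module.algebraMap_end_apply, ← Submodule.Quotient.mk_smul,
        Algebra.smul_def]
    | ι x => intro s; rw [TensorAlgebra.lift_ι_apply]; rfl
    | mul a b ha hb => intro s; rw [map_mul, Module.End.mul_apply, hb, ha, mul_assoc]
    | add a b ha hb =>
      intro s; rw [map_add, LinearMap.add_apply, ha, hb, add_mul, Submodule.Quotient.mk_add]
  have hr' : ∀ t, ∀ s ∈ J, s * t ∈ J := by
    intro t
    induction t using TensorAlgebra.induction with
    | algebraMap r =>
      intro s hs
      rw [← Algebra.commutes, ← Algebra.smul_def]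
      exact J.smul_mem _ hs
    | ι x => exact fun s hs => hr x s hs
    | mul a b ha hb => intro s hs; rw [← mul_assoc]; exact hb _ (ha _ hs)
    | add a b ha hb => intro s hs; rw [mul_add]; exact add_mem (ha _ hs) (hb _ hs)
  let q : Alg S →ₐ[K] Module.End K (TensorAlgebra K E ⧸ J) :=
    RingQuot.liftAlgHom K ⟨TensorAlgebra.lift K act, by
      rintro a b ⟨ha, rfl⟩
      rw [map_zero]
      refine LinearMap.ext fun z => ?_
      obtain ⟨z, rfl⟩ := Submodule.Quotient.mk_surjective _ z
      rw [key, LinearMap.zero_apply, Submodule.Quotient.mk_eq_zero]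
      exact hr' _ _ (hS ha)⟩
  have hq : q (proj S t) = TensorAlgebra.lift K act t :=
    RingQuot.liftAlgHom_mkAlgHom_apply ..
  rw [ht, map_zero] at hq
  have := key t 1
  rw [← hq, mul_one, LinearMap.zero_apply, eq_comm, Submodule.Quotient.mk_eq_zero] at this
  exact this

/-- If the relations `S` have only homogeneous consequences in a graded family of subspaces
`F k` of an algebra `B`, so do all elements of the ideal `[S]`. -/
theorem map_tcomp_mem_of_proj_eq_zero {B : Type*} [Ring B] [Algebra K B]
    (p : TensorAlgebra K E →ₐ[K] B) (F : ℕ → Submodule K B)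
    (hl : ∀ k x, ∀ a ∈ F k, p (TensorAlgebra.ι K x) * a ∈ F (k + 1))
    (hr : ∀ k x, ∀ a ∈ F k, a * p (TensorAlgebra.ι K x) ∈ F (k + 1))
    (hS : ∀ s ∈ S, ∀ k, p (tcomp k s) ∈ F k) {t : TensorAlgebra K E} (ht : proj S t = 0) (k : ℕ) :
    p (tcomp k t) ∈ F k := by
  let J : Submodule K (TensorAlgebra K E) :=
    ⨅ k, (F k).comap (p.toLinearMap ∘ₗ tcomp k)
  have hJ : ∀ t, t ∈ J ↔ ∀ k, p (tcomp k t) ∈ F k := fun t => by simp [J]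
  refine (hJ t).1 (mem_of_proj_eq_zero J (fun s hs => (hJ s).2 (hS s hs)) ?_ ?_ ht) k
  · intro x t ht
    refine (hJ _).2 fun k => ?_
    cases k with
    | zero => rw [tcomp_ι_mul_zero, map_zero]; exact zero_mem _
    | succ k => rw [tcomp_ι_mul_succ, map_mul]; exact hl _ _ _ ((hJ t).1 ht k)
  · intro x t ht
    refine (hJ _).2 fun k => ?_
    cases k with
    | zero => rw [tcomp_mul_ι_zero, map_zero]; exact zero_mem _
    | succ k => rw [tcomp_mul_ι_succ, map_mul]; exact hr _ _ _ ((hJ t).1 ht k)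

/-- Homogeneous components of elements of the ideal generated by quadratic relations lie in it. -/
theorem proj_tcomp_eq_zero (R : Set (E ⊗[K] E)) {t : TensorAlgebra K E}
    (ht : proj (sq '' R) t = 0) (k : ℕ) : proj (sq '' R) (tcomp k t) = 0 := by
  refine map_tcomp_mem_of_proj_eq_zero (S := sq '' R) (proj (sq '' R)) (fun _ => ⊥) ?_ ?_ ?_ ht k
  · rintro k x a rfl; simp
  · rintro k x a rfl; simp
  · rintro _ ⟨r, hr, rfl⟩ k
    by_cases h : 2 = k
    · subst h
      rw [tcomp_of_mem (sq_mem r)]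
      exact proj_of_mem _ ⟨r, hr, rfl⟩
    · rw [tcomp_of_mem_ne (sq_mem r) h, map_zero]; exact zero_mem _

variable (S) in
/-- A linear section of `T(E) → T(E) / [S]`. -/
def lift : Alg S →ₗ[K] TensorAlgebra K E :=
  Classical.choose ((proj S).toLinearMap.exists_rightInverse_of_surjective
    (LinearMap.range_eq_top.2 (proj_surjective S)))

theorem proj_lift (a : Alg S) : proj S (lift S a) = a :=
  LinearMap.congr_fun (Classical.choose_spec
    ((proj S).toLinearMap.exists_rightInverse_of_surjective
      (LinearMap.range_eq_top.2 (proj_surjective S)))) a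

variable (S) in
/-- The projection of `T(E) / [S]` onto its component of degree `n` (meaningful only when `S` is
homogeneous). -/
def component (n : ℕ) : Alg S →ₗ[K] Alg S :=
  (proj S).toLinearMap ∘ₗ tcomp n ∘ₗ lift S

theorem component_proj (R : Set (E ⊗[K] E)) (n : ℕ) (t : TensorAlgebra K E) :
    component (sq '' R) n (proj _ t) = proj _ (tcomp n t) := by
  rw [← sub_eq_zero]
  have : proj (sq '' R) (lift (sq '' R) (proj _ t) - t) = 0 := by
    rw [map_sub, proj_lift, sub_self]
  have h := proj_tcomp_eq_zero R this n
  rwa [map_sub, map_sub] at h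

theorem component_mem (n : ℕ) (a : Alg S) : component S n a ∈ degPart S n :=
  ⟨_, tcomp_mem n _, rfl⟩

theorem component_of_mem (R : Set (E ⊗[K] E)) {n : ℕ} {a : Alg (sq '' R)}
    (ha : a ∈ degPart (sq '' R) n) : component (sq '' R) n a = a := by
  obtain ⟨t, ht, rfl⟩ := ha
  exact (component_proj R n t).trans (by rw [tcomp_of_mem ht]; rfl)

theorem component_of_mem_ne (R : Set (E ⊗[K] E)) {m n : ℕ} (h : m ≠ n) {a : Alg (sq '' R)}
    (ha : a ∈ degPart (sq '' R) m) : component (sq '' R) n a = 0 := by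
  obtain ⟨t, ht, rfl⟩ := ha
  exact (component_proj R n t).trans (by rw [tcomp_of_mem_ne ht h, map_zero])

/-! ### Degree and filtration -/

theorem degPart_eq (S : Set (TensorAlgebra K E)) (n : ℕ) :
    degPart S n = LinearMap.range (gen S) ^ n := by
  rw [degPart, Submodule.map_pow, gen, LinearMap.range_comp]

theorem iSup_degPart (S : Set (TensorAlgebra K E)) : ⨆ n, degPart S n = ⊤ := by
  simp only [degPart]
  rw [← Submodule.map_iSup, (DirectSum.Decomposition.isInternal (tpow K E)).submodule_iSup_eq_top,
    Submodule.map_top]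
  exact LinearMap.range_eq_top.2 (proj_surjective S)

instance [FiniteDimensional K E] (S : Set (TensorAlgebra K E)) (n : ℕ) :
    FiniteDimensional K (degPart S n) := by
  rw [degPart_eq]
  exact Module.Finite.iff_fg.2
    (Submodule.FG.pow (Module.Finite.iff_fg.1 inferInstance) n)

/-- Instance search does not find this through the ring structure of a quotient. -/
instance (S : Set (TensorAlgebra K E)) (N : Submodule K (Alg S)) : Module.Free K N :=
  Module.Free.of_divisionRing K N

theorem gen_mem (x : E) : gen S x ∈ degPart S 1 := by rw [degPart_eq, pow_one]; exact ⟨x, rfl⟩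

theorem mul_mem_degPart {m n : ℕ} {a b : Alg S} (ha : a ∈ degPart S m) (hb : b ∈ degPart S n) :
    a * b ∈ degPart S (m + n) := by
  rw [degPart_eq] at *
  rw [pow_add]
  exact Submodule.mul_mem_mul ha hb

theorem gen_mul_mem {n : ℕ} (x : E) {a : Alg S} (ha : a ∈ degPart S n) :
    gen S x * a ∈ degPart S (n + 1) := add_comm 1 n ▸ mul_mem_degPart (gen_mem x) ha

theorem mul_gen_mem {n : ℕ} (x : E) {a : Alg S} (ha : a ∈ degPart S n) :
    a * gen S x ∈ degPart S (n + 1) := mul_mem_degPart ha (gen_mem x)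

theorem one_mem_degPart : (1 : Alg S) ∈ degPart S 0 := by
  rw [degPart_eq, pow_zero]; exact Submodule.one_le.1 le_rfl

theorem mem_degPart_zero {a : Alg S} (ha : a ∈ degPart S 0) : ∃ c : K, a = algebraMap K _ c := by
  rw [degPart_eq, pow_zero] at ha
  obtain ⟨c, hc⟩ := Submodule.mem_one.1 ha
  exact ⟨c, hc.symm⟩

/-- A property of elements of `T(E) / [S]` of degree `n` may be proved on products of generators. -/
theorem degPart_induction {P : ℕ → Alg S → Prop}
    (zero : ∀ c : K, P 0 (algebraMap K _ c))
    (add : ∀ n a b, P n a → P n b → P n (a + b))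
    (mul : ∀ n x, ∀ a ∈ degPart S n, P n a → P (n + 1) (gen S x * a)) {n : ℕ} {a : Alg S}
    (ha : a ∈ degPart S n) : P n a := by
  rw [degPart_eq] at ha
  refine Submodule.pow_induction_on_left' (C := fun n a _ => P n a) (LinearMap.range (gen S))
    (fun c => zero c) (fun x y i _ _ hx hy => add i x y hx hy) ?_ ha
  rintro _ ⟨x, rfl⟩ i a ha h
  rw [← degPart_eq] at ha
  exact mul i x a ha h

theorem filtLT_succ (S : Set (TensorAlgebra K E)) (n : ℕ) :
    filtLT S (n + 1) = filtLT S n ⊔ degPart S n := by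
  refine le_antisymm (iSup₂_le fun m hm => ?_) (sup_le (iSup₂_le fun m hm => ?_) ?_)
  · rcases Nat.lt_succ_iff_lt_or_eq.1 hm with h | rfl
    · exact le_sup_of_le_left (le_iSup₂_of_le m h le_rfl)
    · exact le_sup_right
  · exact le_iSup₂_of_le m (by omega) le_rfl
  · exact le_iSup₂_of_le n (by omega) le_rfl

theorem filtLT_zero (S : Set (TensorAlgebra K E)) : filtLT S 0 = ⊥ := by
  simp [filtLT]

theorem degPart_le_filtLT {m n : ℕ} (h : m < n) : degPart S m ≤ filtLT S n :=
  le_iSup₂_of_le m h le_rfl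

theorem filtLT_mono {m n : ℕ} (h : m ≤ n) : filtLT S m ≤ filtLT S n :=
  iSup₂_le fun _ hk => degPart_le_filtLT (by omega)

theorem mul_gen_mem_filtLT {n : ℕ} (x : E) {a : Alg S} (ha : a ∈ filtLT S n) :
    a * gen S x ∈ filtLT S (n + 1) := by
  have : filtLT S n ≤ (filtLT S (n + 1)).comap (LinearMap.mulRight K (gen S x)) :=
    iSup₂_le fun m hm a ha => degPart_le_filtLT (by omega) (mul_gen_mem x ha)
  exact this ha

theorem gen_mul_mem_filtLT {n : ℕ} (x : E) {a : Alg S} (ha : a ∈ filtLT S n) :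
    gen S x * a ∈ filtLT S (n + 1) := by
  have : filtLT S n ≤ (filtLT S (n + 1)).comap (LinearMap.mulLeft K (gen S x)) :=
    iSup₂_le fun m hm a ha => degPart_le_filtLT (by omega) (gen_mul_mem x ha)
  exact this ha

theorem iSup_filtLT (S : Set (TensorAlgebra K E)) : ⨆ n, filtLT S n = ⊤ := by
  rw [eq_top_iff, ← iSup_degPart S]
  exact iSup_le fun n => le_iSup_of_le (n + 1) (degPart_le_filtLT n.lt_succ_self)

theorem exists_mem_filtLT_of_fg {N : Submodule K (Alg S)} (hN : N.FG) : ∃ n, N ≤ filtLT S n := by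
  obtain ⟨s, hs⟩ := CompleteLattice.IsCompactElement.exists_finset_of_le_iSup _
    ((Submodule.fg_iff_compact N).1 hN) (filtLT S)
    (by rw [iSup_filtLT]; exact le_top)
  exact ⟨s.sup id, hs.trans (iSup₂_le fun n hn => filtLT_mono (Finset.le_sup (f := id) hn))⟩

/-! ### Low degrees of a quadratic algebra -/

variable (R : Submodule K (E ⊗[K] E))

/-- The action of `E` on `K × E × (E ⊗ E) / R` by left multiplication, this being the truncation
of the quadratic algebra `T(E) / [R]` to degrees at most two. -/
def truncAct : E →ₗ[K] Module.End K (K × E × ((E ⊗[K] E) ⧸ R)) where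
  toFun x := LinearMap.prod 0 (LinearMap.prod
    (LinearMap.toSpanSingleton K E x ∘ₗ LinearMap.fst K K _)
    (R.mkQ ∘ₗ TensorProduct.mk K E E x ∘ₗ LinearMap.fst K E _ ∘ₗ LinearMap.snd K K _))
  map_add' x y := by
    ext <;> simp
  map_smul' c x := by
    refine LinearMap.ext fun v => Prod.ext (smul_zero c).symm (Prod.ext (smul_comm v.1 c x) ?_)
    exact (congrArg R.mkQ (TensorProduct.smul_tmul' c x v.2.1).symm).trans (map_smul R.mkQ c _)

theorem lift_truncAct_ι (x : E) (v) :
    TensorAlgebra.lift K (truncAct R) (TensorAlgebra.ι K x) v =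
      (0, v.1 • x, Submodule.Quotient.mk (x ⊗ₜ v.2.1)) := by
  simp [truncAct]

theorem lift_truncAct_sq (s : E ⊗[K] E) (v) :
    TensorAlgebra.lift K (truncAct R) (sq s) v = (0, 0, Submodule.Quotient.mk (v.1 • s)) := by
  induction s using TensorProduct.induction_on with
  | zero => simp; rfl
  | tmul x y =>
    rw [sq, TensorProduct.lift.tmul, LinearMap.compl₁₂_apply, LinearMap.mul_apply', map_mul,
      Module.End.mul_apply, lift_truncAct_ι, lift_truncAct_ι]
    simp
  | add x y hx hy =>
    rw [map_add, map_add, LinearMap.add_apply, hx, hy, smul_add, Submodule.Quotient.mk_add]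
    simp

/-- The algebra `T(E) / [R]` acts on its truncation. -/
def trunc : Alg (sq '' (R : Set (E ⊗[K] E))) →ₐ[K] Module.End K (K × E × ((E ⊗[K] E) ⧸ R)) :=
  RingQuot.liftAlgHom K ⟨TensorAlgebra.lift K (truncAct R), by
    rintro _ b ⟨⟨r, hr, rfl⟩, rfl⟩
    rw [map_zero]
    refine LinearMap.ext fun v => ?_
    rw [lift_truncAct_sq, (Submodule.Quotient.mk_eq_zero _).2 (R.smul_mem _ hr)]
    rfl⟩

theorem trunc_proj (t : TensorAlgebra K E) :
    trunc R (proj _ t) = TensorAlgebra.lift K (truncAct R) t :=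
  RingQuot.liftAlgHom_mkAlgHom_apply ..

variable {R}

/-- The ideal generated by `R` contains no tensors of degree two besides those in `R`. -/
theorem mem_of_proj_sq_eq_zero {s : E ⊗[K] E}
    (h : proj (sq '' (R : Set (E ⊗[K] E))) (sq s) = 0) : s ∈ R := by
  have := congrArg (fun f => (f (1, 0, 0)).2.2) (trunc_proj R (sq s))
  rw [h] at this
  rw [lift_truncAct_sq, map_zero, one_smul] at this
  exact (Submodule.Quotient.mk_eq_zero _).1 this.symm

variable (R) in
/-- The coordinate of degree one of an element of a quadratic algebra. -/
def coordOne : Alg (sq '' (R : Set (E ⊗[K] E))) →ₗ[K] E :=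
  LinearMap.fst K E _ ∘ₗ LinearMap.snd K K _ ∘ₗ LinearMap.applyₗ (1, 0, 0) ∘ₗ
    (trunc R).toLinearMap

theorem coordOne_gen (x : E) : coordOne R (gen _ x) = x := by
  have := congrArg (fun f => (f (1, 0, 0)).2.1) (trunc_proj R (TensorAlgebra.ι K x))
  rw [lift_truncAct_ι, one_smul] at this
  exact this

end Presented

namespace Prealgebra

open Presented

variable {K E : Type u} [Field K] [AddCommGroup E] [Module K E] (L : Prealgebra K E)

/-! ### The consequences of the Poincaré–Birkhoff–Witt property in degree three -/

variable {L} in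
theorem mem_R_of_proj_env_sq (h : L.HasPBW) {s : E ⊗[K] E}
    (hs : proj L.envRel (sq s) = 0) : s ∈ L.R :=
  mem_of_proj_sq_eq_zero (h 2 _ (sq_mem s) (by rw [hs]; exact zero_mem _))

variable {L} in
theorem gen_env_injective (h : L.HasPBW) : Function.Injective (gen L.envRel) := by
  refine (injective_iff_map_eq_zero _).2 fun x hx => ?_
  have := h 1 (TensorAlgebra.ι K x) (ι_mem x) (by rw [proj_ι, hx]; exact zero_mem _)
  rw [← coordOne_gen (R := L.R) x]
  exact (congrArg _ this).trans (map_zero _)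

theorem proj_env_sq (r : L.R) : proj L.envRel (sq (r : E ⊗[K] E)) = gen L.envRel (L.φ r) := by
  rw [← sub_eq_zero, ← proj_ι, ← map_sub]
  exact proj_of_mem _ ⟨r, rfl⟩

theorem proj_dual_sq {t : Module.Dual K E ⊗[K] Module.Dual K E} (ht : t ∈ L.perp) :
    proj L.dualRel (sq t) = 0 :=
  proj_of_mem _ ⟨t, ht, rfl⟩

theorem proj_sq_tmul {E : Type u} [AddCommGroup E] [Module K E] (S : Set (TensorAlgebra K E))
    (x y : E) : proj S (sq (x ⊗ₜ y)) = gen S x * gen S y := by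
  simp [Presented.sq, gen]

section

variable {ι : Type*} [Fintype ι] (b : Module.Basis ι K E)

/-- The tensor `∑ η(ω_λ ω_μ) x^λ ⊗ x^μ` attached to a linear form `η` on the Koszul dual. -/
def quadTensor : Module.Dual K L.KDual →ₗ[K] E ⊗[K] E where
  toFun η := ∑ i, ∑ j, η (gen _ (b.coord i) * gen _ (b.coord j)) • (b i ⊗ₜ[K] b j)
  map_add' η η' := by simp [add_smul, Finset.sum_add_distrib]
  map_smul' c η := by simp [Finset.smul_sum, mul_smul]

theorem quadTensor_apply (η : Module.Dual K L.KDual) : L.quadTensor b η =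
    ∑ i, ∑ j, η (gen _ (b.coord i) * gen _ (b.coord j)) • (b i ⊗ₜ[K] b j) := rfl

theorem sum_dual_apply_smul {F : Type*} [AddCommGroup F] [Module K F]
    (f : Module.Dual K E →ₗ[K] F) (ω : Module.Dual K E) :
    ∑ i, ω (b i) • f (b.coord i) = f ω := by
  classical
  simp_rw [← map_smul, ← map_sum]
  exact congrArg f (b.sum_dual_apply_smul_coord ω)

theorem dualDistrib_quadTensor (η : Module.Dual K L.KDual)
    (t : Module.Dual K E ⊗[K] Module.Dual K E) :
    TensorProduct.dualDistrib K E E t (L.quadTensor b η) = η (proj L.dualRel (sq t)) := by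
  induction t using TensorProduct.induction_on with
  | zero => simp
  | tmul x y =>
    rw [proj_sq_tmul, ← sum_dual_apply_smul b (gen L.dualRel) x,
      ← sum_dual_apply_smul b (gen L.dualRel) y]
    simp only [quadTensor_apply, map_sum, map_smul, TensorProduct.dualDistrib_apply,
      Finset.sum_mul_sum, smul_eq_mul, smul_mul_assoc, mul_smul_comm]
    refine Finset.sum_congr rfl fun i _ => Finset.sum_congr rfl fun j _ => ?_
    ring
  | add x y hx hy => simp only [map_add, LinearMap.add_apply, hx, hy]

variable [FiniteDimensional K E]

theorem mem_R_of_perp {s : E ⊗[K] E}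
    (h : ∀ t ∈ L.perp, TensorProduct.dualDistrib K E E t s = 0) : s ∈ L.R := by
  rw [← Subspace.dualAnnihilator_dualCoannihilator_eq (W := L.R), Submodule.mem_dualCoannihilator]
  intro ψ hψ
  obtain ⟨t, rfl⟩ := (TensorProduct.dualDistribEquiv K E E).surjective ψ
  exact h t hψ

theorem quadTensor_mem (η : Module.Dual K L.KDual) : L.quadTensor b η ∈ L.R :=
  L.mem_R_of_perp fun t ht => by rw [dualDistrib_quadTensor, proj_dual_sq _ ht, map_zero]

/-- `quadTensor` as an element of `R = (𝒜^!_2)^*`. -/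
def quadRest : Module.Dual K L.KDual →ₗ[K] L.R :=
  (L.quadTensor b).codRestrict L.R (L.quadTensor_mem b)

theorem coe_quadRest (η : Module.Dual K L.KDual) : (L.quadRest b η : E ⊗[K] E) =
    L.quadTensor b η := rfl

theorem proj_env_quadTensor (η : Module.Dual K L.KDual) :
    ∑ i, ∑ j, η (gen _ (b.coord i) * gen _ (b.coord j)) •
      (gen L.envRel (b i) * gen L.envRel (b j)) = gen L.envRel (L.φ (L.quadRest b η)) := by
  rw [← proj_env_sq, coe_quadRest, quadTensor_apply]
  simp only [map_sum, map_smul, proj_sq_tmul]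

/-- For a linear form `ξ` on the Koszul dual, which may be seen as a tensor `w` in
`(R ⊗ E) ∩ (E ⊗ R)`, the tensor `(φ ⊗ 1 - 1 ⊗ φ)(w)`. -/
def jacobiator (ξ : Module.Dual K L.KDual) : E ⊗[K] E :=
  ∑ i, L.φ (L.quadRest b (ξ ∘ₗ LinearMap.mulRight K (gen _ (b.coord i)))) ⊗ₜ[K] b i -
    ∑ i, b i ⊗ₜ[K] L.φ (L.quadRest b (ξ ∘ₗ LinearMap.mulLeft K (gen _ (b.coord i))))

/-- In `𝔄`, where `φ(r) = r`, both terms of the jacobiator become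
`∑ ξ(ω_λ ω_μ ω_ν) x^λ x^μ x^ν`. -/
theorem proj_env_jacobiator (ξ : Module.Dual K L.KDual) :
    proj L.envRel (sq (L.jacobiator b ξ)) = 0 := by
  simp only [jacobiator, map_sub, map_sum, proj_sq_tmul, ← proj_env_quadTensor,
    Finset.sum_mul, Finset.mul_sum]
  rw [sub_eq_zero, Finset.sum_comm]
  refine Finset.sum_congr rfl fun i _ => ?_
  rw [Finset.sum_comm]
  refine Finset.sum_congr rfl fun j _ => Finset.sum_congr rfl fun k _ => ?_
  simp [mul_assoc]

variable {L} in
theorem jacobiator_mem (h : L.HasPBW) (ξ : Module.Dual K L.KDual) : L.jacobiator b ξ ∈ L.R :=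
  mem_R_of_proj_env_sq h (L.proj_env_jacobiator b ξ)

variable {L} in
/-- With `jacobiator_mem`, this is the form which the Jacobi identity takes for a prealgebra. -/
theorem φ_jacobiator (h : L.HasPBW) (ξ : Module.Dual K L.KDual) :
    L.φ ⟨L.jacobiator b ξ, jacobiator_mem b h ξ⟩ = 0 := by
  refine gen_env_injective h ?_
  rw [← proj_env_sq, map_zero]
  exact L.proj_env_jacobiator b ξ

end

/-! ### The differential of the Koszul dual -/

variable [FiniteDimensional K E]

theorem exists_transpose : ∃ D : Module.Dual K E →ₗ[K] Module.Dual K E ⊗[K] Module.Dual K E,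
    ∀ ω, ∀ r : L.R, TensorProduct.dualDistrib K E E (D ω) r = -ω (L.φ r) := by
  have hs : Function.Surjective
      (L.R.subtype.dualMap ∘ₗ (TensorProduct.dualDistribEquiv K E E).toLinearMap) :=
    (LinearMap.dualMap_surjective_of_injective L.R.injective_subtype).comp
      (TensorProduct.dualDistribEquiv K E E).surjective
  obtain ⟨s, hs⟩ := LinearMap.exists_rightInverse_of_surjective _ (LinearMap.range_eq_top.2 hs)
  refine ⟨(-1 : K) • (s ∘ₗ L.φ.dualMap), fun ω r => ?_⟩
  have := LinearMap.congr_fun (LinearMap.congr_fun hs (L.φ.dualMap ω)) r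
  rw [LinearMap.smul_apply, map_smul, LinearMap.smul_apply, neg_one_smul]
  exact congrArg _ this

/-- A lift of `-φ^t : E^* → R^*` to a map with values in `E^* ⊗ E^*`. -/
def transpose : Module.Dual K E →ₗ[K] Module.Dual K E ⊗[K] Module.Dual K E :=
  Classical.choose L.exists_transpose

theorem dualDistrib_transpose (ω : Module.Dual K E) (r : L.R) :
    TensorProduct.dualDistrib K E E (L.transpose ω) r = -ω (L.φ r) :=
  Classical.choose_spec L.exists_transpose ω r

/-- The map `-φ^t : E^* → 𝒜^!_2`. -/
def genD : Module.Dual K E →ₗ[K] L.KDual :=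
  (proj L.dualRel).toLinearMap ∘ₗ sq ∘ₗ L.transpose

theorem genD_mem (ω : Module.Dual K E) : L.genD ω ∈ degPart L.dualRel 2 :=
  proj_mem_degPart _ (sq_mem _)

theorem genD_eq (ω : Module.Dual K E) (t : Module.Dual K E ⊗[K] Module.Dual K E)
    (h : ∀ r : L.R, TensorProduct.dualDistrib K E E t r = -ω (L.φ r)) :
    L.genD ω = proj L.dualRel (sq t) := by
  rw [← sub_eq_zero]
  change proj L.dualRel (sq (L.transpose ω)) - _ = 0
  rw [← map_sub, ← map_sub]
  refine L.proj_dual_sq ?_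
  rw [perp, Submodule.mem_comap, Submodule.mem_dualAnnihilator]
  intro r hr
  rw [map_sub, LinearMap.sub_apply, h ⟨r, hr⟩, dualDistrib_transpose L ω ⟨r, hr⟩, sub_self]

theorem apply_genD {ι : Type*} [Fintype ι] (b : Module.Basis ι K E) (η : Module.Dual K L.KDual)
    (ω : Module.Dual K E) : η (L.genD ω) = -ω (L.φ (L.quadRest b η)) := by
  rw [← dualDistrib_transpose, coe_quadRest, dualDistrib_quadTensor]
  rfl

/-- The map `E^* ⊗ E^* → 𝒜^!_3` which is to be the restriction of the differential. -/
def sqD : Module.Dual K E ⊗[K] Module.Dual K E →ₗ[K] L.KDual :=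
  TensorProduct.lift ((LinearMap.mul K L.KDual).compl₁₂ L.genD (gen _) +
    (-1 : K) • (LinearMap.mul K L.KDual).compl₁₂ (gen _) L.genD)

theorem sqD_tmul (ω ω' : Module.Dual K E) :
    L.sqD (ω ⊗ₜ ω') = L.genD ω * gen _ ω' + (-1 : K) • (gen _ ω * L.genD ω') := by
  simp [sqD, -neg_smul]

/-- The map `sqD` is minus the transpose of the jacobiator. -/
theorem apply_sqD {ι : Type*} [Fintype ι] (b : Module.Basis ι K E) (ξ : Module.Dual K L.KDual)
    (t : Module.Dual K E ⊗[K] Module.Dual K E) :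
    ξ (L.sqD t) = -TensorProduct.dualDistrib K E E t (L.jacobiator b ξ) := by
  induction t using TensorProduct.induction_on with
  | zero => simp
  | tmul x y =>
    have h1 := L.apply_genD b (ξ ∘ₗ LinearMap.mulRight K (gen _ y)) x
    have h2 := L.apply_genD b (ξ ∘ₗ LinearMap.mulLeft K (gen _ x)) y
    simp only [LinearMap.comp_apply, LinearMap.mulRight_apply, LinearMap.mulLeft_apply] at h1 h2
    rw [sqD_tmul, map_add, map_smul, h1, h2, neg_one_smul]
    let f₁ : Module.Dual K E →ₗ[K] K :=
      { toFun z := x (L.φ (L.quadRest b (ξ ∘ₗ LinearMap.mulRight K (gen _ z))))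
        map_add' z w := by
          rw [← map_add, ← map_add, ← map_add, ← LinearMap.comp_add]
          congr 4; ext; simp [mul_add]
        map_smul' c z := by
          rw [RingHom.id_apply, ← map_smul, ← map_smul, ← map_smul, ← LinearMap.comp_smul]
          congr 4; ext; simp }
    let f₂ : Module.Dual K E →ₗ[K] K :=
      { toFun z := y (L.φ (L.quadRest b (ξ ∘ₗ LinearMap.mulLeft K (gen _ z))))
        map_add' z w := by
          rw [← map_add, ← map_add, ← map_add, ← LinearMap.comp_add]
          congr 4; ext; simp [add_mul]
        map_smul' c z := by
          rw [RingHom.id_apply, ← map_smul, ← map_smul, ← map_smul, ← LinearMap.comp_smul]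
          congr 4; ext; simp }
    have e₁ := sum_dual_apply_smul b f₁ y
    have e₂ := sum_dual_apply_smul b f₂ x
    simp only [f₁, f₂, LinearMap.coe_mk, AddHom.coe_mk, smul_eq_mul] at e₁ e₂
    simp only [jacobiator, map_sub, map_sum, TensorProduct.dualDistrib_apply, ← e₁, ← e₂]
    simp only [mul_comm, neg_sub]
    ring
  | add x y hx hy => simp only [map_add, LinearMap.add_apply, hx, hy, neg_add]

variable {L} in
/-- The differential is well defined since the jacobiator takes values in `R`. -/
theorem sqD_eq_zero (h : L.HasPBW) {t : Module.Dual K E ⊗[K] Module.Dual K E} (ht : t ∈ L.perp) :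
    L.sqD t = 0 := by
  refine (Module.forall_dual_apply_eq_zero_iff K _).1 fun ξ => ?_
  rw [L.apply_sqD (Module.finBasis K E), neg_eq_zero]
  exact (Submodule.mem_dualAnnihilator _).1 ht _ (jacobiator_mem _ h ξ)

variable {L} in
/-- The differential has square zero on generators since `φ` kills the jacobiator. -/
theorem sqD_transpose (h : L.HasPBW) (ω : Module.Dual K E) : L.sqD (L.transpose ω) = 0 := by
  refine (Module.forall_dual_apply_eq_zero_iff K _).1 fun ξ => ?_
  rw [L.apply_sqD (Module.finBasis K E), neg_eq_zero,
    L.dualDistrib_transpose ω ⟨_, jacobiator_mem _ h ξ⟩, φ_jacobiator _ h, map_zero, neg_zero]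

/-- The assignment `ω ↦ (-ω, -φ^t ω; 0, ω)`. The antiderivation property says that
`α ↦ ((-1)^{|α|} α, δ α; 0, α)` is multiplicative. The sign is the scalar `-1 : K`, as in that
property. -/
def matGen : Module.Dual K E →ₗ[K] Matrix (Fin 2) (Fin 2) L.KDual where
  toFun ω := !![(-1 : K) • gen _ ω, L.genD ω; 0, gen _ ω]
  map_add' x y := by ext i j; fin_cases i <;> fin_cases j <;> simp [-neg_smul]
  map_smul' c x := by
    ext i j; fin_cases i <;> fin_cases j <;> simp [smul_comm c, -neg_smul]

theorem lift_matGen_sq (t : Module.Dual K E ⊗[K] Module.Dual K E) :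
    TensorAlgebra.lift K L.matGen (sq t) =
      !![proj L.dualRel (sq t), L.sqD t; 0, proj L.dualRel (sq t)] := by
  induction t using TensorProduct.induction_on with
  | zero => ext i j; fin_cases i <;> fin_cases j <;> simp
  | tmul x y =>
    have : TensorAlgebra.lift K L.matGen (Presented.sq (x ⊗ₜ y)) = L.matGen x * L.matGen y := by
      simp only [Presented.sq, TensorProduct.lift.tmul, LinearMap.compl₁₂_apply,
        LinearMap.mul_apply', map_mul, TensorAlgebra.lift_ι_apply]
    rw [this, proj_sq_tmul, sqD_tmul]
    simp only [matGen, LinearMap.coe_mk, AddHom.coe_mk, Matrix.mul_fin_two, mul_zero, zero_mul,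
      add_zero, zero_add, smul_mul_assoc]
    rw [add_comm (L.genD x * _), mul_smul_comm, smul_smul, neg_mul_neg, one_mul, one_smul]
  | add x y hx hy =>
    rw [map_add, map_add, hx, hy]
    ext i j; fin_cases i <;> fin_cases j <;> simp

variable {L}

/-- The algebra homomorphism `α ↦ ((-1)^{|α|} α, δ α; 0, α)`. -/
def matHom (h : L.HasPBW) : L.KDual →ₐ[K] Matrix (Fin 2) (Fin 2) L.KDual :=
  RingQuot.liftAlgHom K ⟨TensorAlgebra.lift K L.matGen, by
    rintro _ b ⟨⟨t, ht, rfl⟩, rfl⟩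
    rw [lift_matGen_sq, sqD_eq_zero h ht, proj_dual_sq _ ht, map_zero]
    ext i j; fin_cases i <;> fin_cases j <;> simp⟩

theorem matHom_gen (h : L.HasPBW) (ω : Module.Dual K E) :
    matHom h (gen _ ω) = !![(-1 : K) • gen _ ω, L.genD ω; 0, gen _ ω] :=
  (RingQuot.liftAlgHom_mkAlgHom_apply ..).trans (TensorAlgebra.lift_ι_apply ..)

/-- The differential of the Koszul dual. -/
def differential (h : L.HasPBW) : L.KDual →ₗ[K] L.KDual :=
  (Matrix.entryLinearMap K L.KDual 0 1) ∘ₗ (matHom h).toLinearMap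

theorem matHom_apply_one (h : L.HasPBW) (α : L.KDual) :
    matHom h α 1 0 = 0 ∧ matHom h α 1 1 = α := by
  obtain ⟨t, rfl⟩ := proj_surjective _ α
  induction t using TensorAlgebra.induction with
  | algebraMap r => simp [AlgHom.commutes, Matrix.algebraMap_matrix_apply]
  | ι x =>
    rw [proj_ι, matHom_gen]
    simp
  | mul a b ha hb =>
    rw [map_mul, map_mul]
    simp [Matrix.mul_apply, ha, hb, Fin.sum_univ_two]
  | add a b ha hb => simp [ha, hb]

theorem matHom_apply_zero (h : L.HasPBW) {n : ℕ} {α : L.KDual} (hα : α ∈ degPart L.dualRel n) :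
    matHom h α 0 0 = (-1 : K) ^ n • α := by
  refine degPart_induction (P := fun n α => matHom h α 0 0 = (-1 : K) ^ n • α) ?_ ?_ ?_ hα
  · intro c; simp [AlgHom.commutes, Matrix.algebraMap_matrix_apply]
  · intro n a b ha hb; simp [ha, hb]
  · intro n x a _ ha
    rw [map_mul, Matrix.mul_apply, Fin.sum_univ_two, ha, (matHom_apply_one h a).1, matHom_gen]
    simp [pow_succ, smul_smul, -neg_smul]

theorem differential_mul (h : L.HasPBW) {n : ℕ} {α : L.KDual} (hα : α ∈ degPart L.dualRel n)
    (β : L.KDual) : differential h (α * β) =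
      differential h α * β + (-1 : K) ^ n • (α * differential h β) := by
  change matHom h (α * β) 0 1 = matHom h α 0 1 * β + (-1 : K) ^ n • (α * matHom h β 0 1)
  rw [map_mul, Matrix.mul_apply, Fin.sum_univ_two, matHom_apply_zero h hα,
    (matHom_apply_one h β).2, add_comm, smul_mul_assoc]

theorem differential_gen (h : L.HasPBW) (ω : Module.Dual K E) :
    differential h (gen _ ω) = L.genD ω := by
  change matHom h _ 0 1 = _
  rw [matHom_gen]; simp

theorem differential_gen_mul (h : L.HasPBW) (ω : Module.Dual K E) (α : L.KDual) :
    differential h (gen _ ω * α) = L.genD ω * α + (-1 : K) • (gen _ ω * differential h α) := by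
  rw [differential_mul h (gen_mem ω), differential_gen, pow_one]

theorem differential_algebraMap (h : L.HasPBW) (c : K) :
    differential h (algebraMap K _ c) = 0 := by
  change matHom h _ 0 1 = 0
  rw [AlgHom.commutes]; simp [Matrix.algebraMap_matrix_apply]

theorem differential_mem (h : L.HasPBW) {n : ℕ} {α : L.KDual} (hα : α ∈ degPart L.dualRel n) :
    differential h α ∈ degPart L.dualRel (n + 1) := by
  refine degPart_induction (P := fun n α => differential h α ∈ degPart L.dualRel (n + 1))
    ?_ ?_ ?_ hα
  · intro c; rw [differential_algebraMap]; exact zero_mem _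
  · intro n a b ha hb; rw [map_add]; exact add_mem ha hb
  · intro n x a ha' ha
    rw [differential_gen_mul]
    refine add_mem ?_ (Submodule.smul_mem _ _ (gen_mul_mem _ ha))
    have := mul_mem_degPart (L.genD_mem x) ha'
    rwa [add_comm 2 n] at this

theorem differential_degree (h : L.HasPBW) (n : ℕ) :
    (degPart L.dualRel n).map (differential h) ≤ degPart L.dualRel (n + 1) := by
  rintro _ ⟨α, hα, rfl⟩
  exact differential_mem h hα

theorem differential_sq (h : L.HasPBW) (t : Module.Dual K E ⊗[K] Module.Dual K E) :
    differential h (proj _ (sq t)) = L.sqD t := by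
  induction t using TensorProduct.induction_on with
  | zero => simp
  | tmul x y => rw [proj_sq_tmul, differential_gen_mul, sqD_tmul, differential_gen]
  | add x y hx hy => simp [hx, hy]

theorem differential_genD (h : L.HasPBW) (ω : Module.Dual K E) :
    differential h (L.genD ω) = 0 :=
  (differential_sq h _).trans (sqD_transpose h ω)

theorem differential_differential (h : L.HasPBW) (α : L.KDual) :
    differential h (differential h α) = 0 := by
  have : ⊤ ≤ LinearMap.ker (differential h ∘ₗ differential h) := by
    rw [← iSup_degPart]
    refine iSup_le fun n α hα => ?_
    refine degPart_induction (P := fun _ α => differential h (differential h α) = 0) ?_ ?_ ?_ hα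
    · intro c; rw [differential_algebraMap, map_zero]
    · intro n a b ha hb; rw [map_add, map_add, ha, hb, add_zero]
    · intro n x a _ ha
      rw [differential_gen_mul, map_add, map_smul, differential_mul h (L.genD_mem x),
        differential_gen_mul, ha, differential_genD, neg_one_sq, one_smul, zero_mul, zero_add,
        mul_zero, smul_zero, add_zero]
      exact (congrArg _ (neg_one_smul K _)).trans (add_neg_cancel _)
  exact this (Submodule.mem_top (x := α))

theorem isDualDifferential (h : L.HasPBW) : L.IsDualDifferential (differential h) where
  degree := differential_degree h
  antiderivation n α hα β := differential_mul h hα β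
  extends_transpose ω t ht := by rw [differential_gen, L.genD_eq ω t ht]

theorem IsDualDifferential.eq_differential (h : L.HasPBW) {δ : L.KDual →ₗ[K] L.KDual}
    (hδ : L.IsDualDifferential δ) : δ = differential h := by
  have h1 : δ 1 = 0 := by
    have := hδ.antiderivation 0 1 one_mem_degPart 1
    rw [mul_one, pow_zero, one_smul, one_mul, mul_one] at this
    exact left_eq_add.1 this
  have : ⊤ ≤ LinearMap.eqLocus δ (differential h) := by
    rw [← iSup_degPart]
    refine iSup_le fun n α hα => ?_
    refine degPart_induction (P := fun _ α => δ α = differential h α) ?_ ?_ ?_ hα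
    · intro c; rw [differential_algebraMap, Algebra.algebraMap_eq_smul_one, map_smul, h1, smul_zero]
    · intro n a b ha hb; rw [map_add, map_add, ha, hb]
    · intro n x a _ ha
      rw [differential_gen_mul, hδ.antiderivation 1 _ (gen_mem x), ha, pow_one,
        hδ.extends_transpose x _ (L.dualDistrib_transpose x)]
      rfl
  exact LinearMap.ext fun α => this (Submodule.mem_top (x := α))

end Prealgebra

/-! ### Separation of tensors by linear forms -/

section Separation

variable {K M N : Type*} [Field K] [AddCommGroup M] [Module K M] [AddCommGroup N] [Module K N]

theorem TensorProduct.eq_zero_of_forall_rTensor {x : M ⊗[K] N}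
    (h : ∀ f : Module.Dual K M, TensorProduct.lid K N (f.rTensor N x) = 0) : x = 0 := by
  classical
  let c := Module.Basis.ofVectorSpace K M
  refine (TensorProduct.equivFinsuppOfBasisLeft c).map_eq_zero_iff.1 (Finsupp.ext fun i => ?_)
  rw [TensorProduct.equivFinsuppOfBasisLeft_apply]
  exact h _

theorem TensorProduct.eq_zero_of_forall_lTensor {x : M ⊗[K] N}
    (h : ∀ ξ : Module.Dual K N, TensorProduct.rid K M (ξ.lTensor M x) = 0) : x = 0 := by
  refine TensorProduct.eq_zero_of_forall_rTensor fun f =>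
    (Module.forall_dual_apply_eq_zero_iff K _).1 fun ξ => ?_
  have key : ∀ y : M ⊗[K] N, ξ (TensorProduct.lid K N (f.rTensor N y)) =
      f (TensorProduct.rid K M (ξ.lTensor M y)) := by
    intro y
    induction y using TensorProduct.induction_on with
    | zero => simp
    | tmul m n => simp [mul_comm]
    | add x y hx hy => simp only [map_add, hx, hy]
  rw [key, h ξ, map_zero]

end Separation

namespace Prealgebra

open Presented

variable {K E : Type u} [Field K] [AddCommGroup E] [Module K E] {L : Prealgebra K E}

/-! ### The operators `δ_V` and `δ_W` -/

section Operators

variable [FiniteDimensional K E] {ι : Type*} [Fintype ι] (b : Module.Basis ι K E)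

variable (L) in
/-- The identity `∑ x^λ x^μ ⊗ ω_λ ω_μ + ∑ x^λ ⊗ δ ω_λ = 0` in `𝔄 ⊗ 𝒜^!_2`, a dual form of the
relations `r = φ(r)` of `𝔄`. -/
theorem sum_tmul_add_sum_tmul_eq_zero :
    ∑ i, ∑ j, (gen L.envRel (b i) * gen L.envRel (b j)) ⊗ₜ[K]
      (gen L.dualRel (b.coord i) * gen L.dualRel (b.coord j)) +
      ∑ i, gen L.envRel (b i) ⊗ₜ[K] L.genD (b.coord i) = 0 := by
  refine TensorProduct.eq_zero_of_forall_lTensor fun η => ?_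
  simp only [map_add, map_sum, LinearMap.lTensor_tmul, TensorProduct.rid_tmul, proj_env_quadTensor,
    L.apply_genD b, ← map_smul]
  simp only [neg_smul, ← map_sum, ← map_add, Finset.sum_neg_distrib, Module.Basis.coord_apply,
    b.sum_repr, add_neg_cancel, map_zero]

theorem sum_apply_add_sum_apply_eq_zero {X : Type*} [AddCommGroup X] [Module K X]
    (B : L.Env →ₗ[K] L.KDual →ₗ[K] X) :
    ∑ i, ∑ j, B (gen L.envRel (b i) * gen L.envRel (b j))
      (gen L.dualRel (b.coord i) * gen L.dualRel (b.coord j)) +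
      ∑ i, B (gen L.envRel (b i)) (L.genD (b.coord i)) = 0 := by
  have := congrArg (TensorProduct.lift B) (L.sum_tmul_add_sum_tmul_eq_zero b)
  simpa only [map_add, map_sum, TensorProduct.lift.tmul, map_zero] using this

omit [Fintype ι] in
theorem differential_coord_mul (h : L.HasPBW) (i : ι) (α : L.KDual) :
    differential h (L.mulGen (b.coord i) α) + L.mulGen (b.coord i) (differential h α) =
      L.genD (b.coord i) * α := by
  change differential h (gen _ _ * α) + gen _ _ * _ = _
  rw [differential_gen_mul, add_assoc]
  have : (-1 : K) • (gen L.dualRel (b.coord i) * differential h α) +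
      gen L.dualRel (b.coord i) * differential h α = 0 :=
    (congrArg (· + _) (neg_one_smul K _)).trans (neg_add_cancel _)
  rw [this, add_zero]

omit [FiniteDimensional K E] in
theorem cochainD_tmul {δ : L.KDual →ₗ[K] L.KDual} {V : Type u} [AddCommGroup V] [Module K V]
    [Module L.Env V] [IsScalarTower K L.Env V] (v : V) (α : L.KDual) :
    L.cochainD b δ V (v ⊗ₜ α) =
      ∑ i, (gen L.envRel (b i) • v) ⊗ₜ L.mulGen (b.coord i) α + v ⊗ₜ δ α := by
  simp [cochainD, LinearMap.sum_apply]

omit [FiniteDimensional K E] in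
theorem chainD_tmul {δ : L.KDual →ₗ[K] L.KDual} {W : Type u} [AddCommGroup W] [Module K W]
    [Module L.Envᵐᵒᵖ W] [IsScalarTower K L.Envᵐᵒᵖ W] (w : W) (ξ : Module.Dual K L.KDual) :
    L.chainD b δ W (w ⊗ₜ ξ) =
      ∑ i, (MulOpposite.op (gen L.envRel (b i)) • w) ⊗ₜ (ξ ∘ₗ L.mulGen (b.coord i)) +
        w ⊗ₜ (ξ ∘ₗ δ) := by
  simp only [chainD, contract, LinearMap.add_apply, LinearMap.sum_apply, TensorProduct.map_tmul]
  rfl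

theorem cochainD_cochainD (h : L.HasPBW) (V : Type u) [AddCommGroup V] [Module K V]
    [Module L.Env V] [IsScalarTower K L.Env V] :
    L.cochainD b (differential h) V ∘ₗ L.cochainD b (differential h) V = 0 := by
  refine TensorProduct.ext' fun v α => ?_
  let B : L.Env →ₗ[K] L.KDual →ₗ[K] V ⊗[K] L.KDual :=
    LinearMap.mk₂ K (fun a β => (a • v) ⊗ₜ (β * α))
      (fun a a' β => by rw [add_smul, TensorProduct.add_tmul])
      (fun c a β => by rw [smul_assoc, TensorProduct.smul_tmul'])
      (fun a β β' => by rw [add_mul, TensorProduct.tmul_add])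
      (fun c a β => by rw [smul_mul_assoc, TensorProduct.tmul_smul])
  have key := sum_apply_add_sum_apply_eq_zero b B
  simp only [B, LinearMap.mk₂_apply, ← differential_coord_mul b h, TensorProduct.tmul_add,
    Finset.sum_add_distrib] at key
  rw [Finset.sum_comm] at key
  simp only [LinearMap.comp_apply, cochainD_tmul, map_add, map_sum, Finset.sum_add_distrib,
    differential_differential, TensorProduct.tmul_zero, add_zero, LinearMap.zero_apply]
  rw [← key, add_assoc]
  congr 1
  simp only [mul_smul, mul_assoc]
  rfl

theorem chainD_chainD (h : L.HasPBW) (W : Type u) [AddCommGroup W] [Module K W]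
    [Module L.Envᵐᵒᵖ W] [IsScalarTower K L.Envᵐᵒᵖ W] :
    L.chainD b (differential h) W ∘ₗ L.chainD b (differential h) W = 0 := by
  refine TensorProduct.ext' fun w ξ => ?_
  let B : L.Env →ₗ[K] L.KDual →ₗ[K] W ⊗[K] Module.Dual K L.KDual :=
    LinearMap.mk₂ K (fun a β => (MulOpposite.op a • w) ⊗ₜ (ξ ∘ₗ LinearMap.mulLeft K β))
      (fun a a' β => by rw [MulOpposite.op_add, add_smul, TensorProduct.add_tmul])
      (fun c a β => by rw [MulOpposite.op_smul, smul_assoc, TensorProduct.smul_tmul'])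
      (fun a β β' => by
        rw [← TensorProduct.tmul_add]; congr 1; ext; simp [add_mul])
      (fun c a β => by
        rw [← TensorProduct.tmul_smul]; congr 1; ext; simp)
  have key := sum_apply_add_sum_apply_eq_zero b B
  have hD : ∀ i, ξ ∘ₗ LinearMap.mulLeft K (L.genD (b.coord i)) =
      (ξ ∘ₗ differential h) ∘ₗ L.mulGen (b.coord i) +
        (ξ ∘ₗ L.mulGen (b.coord i)) ∘ₗ differential h := by
    intro i
    ext α
    simp [← differential_coord_mul b h]
  have hξ : (ξ ∘ₗ differential h) ∘ₗ differential h = 0 := by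
    ext α; simp [differential_differential]
  simp only [B, LinearMap.mk₂_apply, hD, TensorProduct.tmul_add, Finset.sum_add_distrib] at key
  simp only [LinearMap.comp_apply, chainD_tmul, map_add, map_sum, Finset.sum_add_distrib,
    hξ, TensorProduct.tmul_zero, add_zero, LinearMap.zero_apply]
  rw [← key, add_assoc, add_comm (∑ i, _ ⊗ₜ[K] ((ξ ∘ₗ differential h) ∘ₗ _))]
  congr 1
  simp only [MulOpposite.op_mul, mul_smul]
  refine Finset.sum_congr rfl fun i _ => Finset.sum_congr rfl fun j _ => ?_
  congr 1
  ext α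
  simp [mulGen]

end Operators

end Prealgebra

/-! ### Linear algebra -/

/-- A linear map of vector spaces has a linear section over its range. Subtraction is recovered from
the action of the field. -/
theorem LinearMap.exists_section_on_range {K X Y : Type*} [Field K] [AddCommMonoid X] [Module K X]
    [AddCommMonoid Y] [Module K Y] (g : X →ₗ[K] Y) :
    ∃ s : Y →ₗ[K] X, ∀ y ∈ LinearMap.range g, g (s y) = y := by
  let _ : AddCommGroup X := Module.addCommMonoidToAddCommGroup K
  let _ : AddCommGroup Y := Module.addCommMonoidToAddCommGroup K
  obtain ⟨s, hs⟩ := g.rangeRestrict.exists_rightInverse_of_surjective g.range_rangeRestrict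
  obtain ⟨s', hs'⟩ := LinearMap.exists_extend s
  refine ⟨s', fun y hy => ?_⟩
  have h1 : s' y = s ⟨y, hy⟩ := LinearMap.congr_fun hs' ⟨y, hy⟩
  rw [h1]
  exact congrArg Subtype.val (LinearMap.congr_fun hs ⟨y, hy⟩)

theorem Homol.exists_of_subsingleton {K M : Type u} [Field K] [AddCommGroup M] [Module K M]
    {d : M →ₗ[K] M} {P Q : Submodule K M} (h : Subsingleton (Homol d P Q)) {z : M} (hz : z ∈ P)
    (hd : d z = 0) : ∃ y ∈ Q, d y = z := by
  have h1 := Submodule.Quotient.subsingleton_iff.1 h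
  have h2 : (⟨z, hz, hd⟩ : cycles d P) ∈ (Q.map d).submoduleOf _ := h1 ▸ Submodule.mem_top
  exact h2

namespace Presented

variable {K E : Type u} [Field K] [AddCommGroup E] [Module K E]

/-! ### Leading terms -/

/-- The projection of `T(E)` onto tensors of degree `p - 1`, which is zero for `p = 0`. -/
def tcompPred : ℕ → TensorAlgebra K E →ₗ[K] TensorAlgebra K E
  | 0 => 0
  | p + 1 => tcomp p

theorem tcomp_mul_ι (p : ℕ) (x : E) (t : TensorAlgebra K E) :
    tcomp p (t * TensorAlgebra.ι K x) = tcompPred p t * TensorAlgebra.ι K x := by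
  cases p with
  | zero => rw [tcomp_mul_ι_zero, tcompPred, LinearMap.zero_apply, zero_mul]
  | succ p => exact tcomp_mul_ι_succ p x t

theorem proj_tcompPred_mem (S : Set (TensorAlgebra K E)) (p : ℕ) (t : TensorAlgebra K E) :
    proj S (tcompPred p t) ∈ filtLT S p := by
  cases p with
  | zero => rw [tcompPred, LinearMap.zero_apply, map_zero]; exact zero_mem _
  | succ p => exact degPart_le_filtLT p.lt_succ_self (proj_mem_degPart S (tcomp_mem p t))

/-- Leading terms of elements of filtration degree `p` may be chosen linearly. -/
theorem exists_leadingTerm (S : Set (TensorAlgebra K E)) (p : ℕ) :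
    ∃ s : Alg S →ₗ[K] TensorAlgebra K E, ∀ a ∈ filtLT S (p + 1),
      s a ∈ tpow K E p ∧ ∃ c ∈ filtLT S p, a = c + proj S (s a) := by
  let g : (filtLT S p) × (tpow K E p) →ₗ[K] Alg S :=
    (filtLT S p).subtype.coprod ((proj S).toLinearMap ∘ₗ (tpow K E p).subtype)
  have hg : filtLT S (p + 1) ≤ LinearMap.range g := by
    rw [filtLT_succ]
    refine sup_le (fun a ha => ⟨(⟨a, ha⟩, 0), by simp [g]⟩) ?_
    rintro _ ⟨t, ht, rfl⟩
    exact ⟨(0, ⟨t, ht⟩), by simp [g]⟩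
  obtain ⟨s, hs⟩ := g.exists_section_on_range
  exact ⟨(tpow K E p).subtype ∘ₗ LinearMap.snd K _ _ ∘ₗ s, fun a ha =>
    ⟨(s a).2.2, _, (s a).1.2, (hs a (hg ha)).symm⟩⟩

end Presented

namespace Prealgebra

open Presented

variable {K E : Type u} [Field K] [AddCommGroup E] [Module K E] (L : Prealgebra K E)

/-! ### Linear maps supported in one degree -/

section Supported

variable (S : Type*) [Ring S] (M : Type*) [AddCommGroup M] [Module K M] [Module S M]
  [SMulCommClass K S M]

/-- The linear maps `𝒜^! → M` which vanish on the components of degree `m ≠ n`, i.e.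
`Hom(𝒜^!_n, M)`. -/
def supported (n : ℕ) : Submodule S (L.KDual →ₗ[K] M) where
  carrier := {f | ∀ m, m ≠ n → ∀ α ∈ degPart L.dualRel m, f α = 0}
  add_mem' hf hg m hm α hα := by rw [LinearMap.add_apply, hf m hm α hα, hg m hm α hα, add_zero]
  zero_mem' _ _ _ _ := rfl
  smul_mem' c f hf m hm α hα := by rw [LinearMap.smul_apply, hf m hm α hα, smul_zero]

instance (n : ℕ) : AddCommGroup (L.supported S M n) := Submodule.addCommGroup _

variable {L S M}

theorem mem_supported {n : ℕ} {f : L.KDual →ₗ[K] M} :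
    f ∈ L.supported S M n ↔ ∀ m, m ≠ n → ∀ α ∈ degPart L.dualRel m, f α = 0 := Iff.rfl

theorem ext_degPart {f g : L.KDual →ₗ[K] M}
    (h : ∀ n, ∀ α ∈ degPart L.dualRel n, f α = g α) : f = g := by
  have : ⊤ ≤ LinearMap.eqLocus f g := by
    rw [← iSup_degPart]; exact iSup_le h
  exact LinearMap.ext fun α => this (Submodule.mem_top (x := α))

theorem supported_ext {n : ℕ} {f g : L.KDual →ₗ[K] M} (hf : f ∈ L.supported S M n)
    (hg : g ∈ L.supported S M n) (h : ∀ α ∈ degPart L.dualRel n, f α = g α) : f = g := by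
  refine ext_degPart fun m α hα => ?_
  by_cases hm : m = n
  · subst hm; exact h α hα
  · rw [hf m hm α hα, hg m hm α hα]

variable (L) in
/-- The projection of the Koszul dual onto its component of degree `n`. -/
def dualComp (n : ℕ) : L.KDual →ₗ[K] degPart L.dualRel n :=
  (component L.dualRel n).codRestrict _ (component_mem n)

theorem dualComp_of_mem {n : ℕ} (α : degPart L.dualRel n) : L.dualComp n α = α :=
  Subtype.ext (component_of_mem _ α.2)

theorem comp_dualComp_mem {n : ℕ} (f : degPart L.dualRel n →ₗ[K] M) :
    f ∘ₗ L.dualComp n ∈ L.supported S M n := by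
  intro m hm α hα
  have : L.dualComp n α = 0 := Subtype.ext (component_of_mem_ne _ hm hα)
  rw [LinearMap.comp_apply, this, map_zero]

theorem mem_codualPart {n : ℕ} {ξ : Module.Dual K L.KDual} :
    ξ ∈ L.codualPart n ↔ ξ ∈ L.supported K K n := by
  simp [codualPart, Submodule.mem_iInf, Submodule.mem_dualAnnihilator, mem_supported]

theorem comp_mem_supported {S' : Type*} [Ring S'] {N : Type*} [AddCommGroup N] [Module K N]
    [Module S' N] [SMulCommClass K S' N] {n : ℕ} {f : L.KDual →ₗ[K] M}
    (hf : f ∈ L.supported S M n) (g : M →ₗ[K] N) :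
    g ∘ₗ f ∈ L.supported S' N n := by
  intro m hm α hα
  rw [LinearMap.comp_apply, hf m hm α hα, map_zero]

end Supported

/-! ### Chains as linear maps -/

section Chains

variable (M : Type*) [AddCommGroup M] [Module K M]

/-- The map `M ⊗ (𝒜^!)^* → Hom(𝒜^!, M)`. -/
def toHom : M ⊗[K] Module.Dual K L.KDual →ₗ[K] L.KDual →ₗ[K] M :=
  TensorProduct.lift LinearMap.smulRightₗ.flip

variable {M}

theorem toHom_tmul (m : M) (ξ : Module.Dual K L.KDual) (α : L.KDual) :
    L.toHom M (m ⊗ₜ ξ) α = ξ α • m := rfl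

theorem toHom_injective : Function.Injective (L.toHom M) := by
  refine (injective_iff_map_eq_zero _).2 fun x hx => ?_
  refine TensorProduct.eq_zero_of_forall_rTensor fun f => LinearMap.ext fun α => ?_
  have key : ∀ y, TensorProduct.lid K _ (f.rTensor (Module.Dual K L.KDual) y) α =
      f (L.toHom M y α) := by
    intro y
    induction y using TensorProduct.induction_on with
    | zero => simp
    | tmul m ξ => simp [toHom_tmul, mul_comm]
    | add x y hx hy => simp only [map_add, LinearMap.add_apply, hx, hy]
  rw [key, hx]
  simp

variable {L}

theorem toHom_mem {M : Type u} [AddCommGroup M] [Module K M] {n : ℕ}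
    {x : M ⊗[K] Module.Dual K L.KDual} (hx : x ∈ L.chains M n) :
    L.toHom M x ∈ L.supported K M n := by
  obtain ⟨y, rfl⟩ := hx
  induction y using TensorProduct.induction_on with
  | zero => rw [map_zero, map_zero]; exact zero_mem _
  | tmul m ξ =>
    intro k hk α hα
    rw [LinearMap.lTensor_tmul, toHom_tmul, Submodule.subtype_apply,
      mem_codualPart.1 ξ.2 k hk α hα, zero_smul]
  | add x y hx hy => rw [map_add, map_add]; exact add_mem hx hy

theorem exists_toHom_eq [FiniteDimensional K E] {M : Type u} [AddCommGroup M] [Module K M] {n : ℕ}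
    {f : L.KDual →ₗ[K] M} (hf : f ∈ L.supported K M n) : ∃ x ∈ L.chains M n, L.toHom M x = f := by
  let c := Module.finBasis K (degPart L.dualRel n)
  let x : M ⊗[K] Module.Dual K L.KDual := ∑ i, f (c i) ⊗ₜ (c.coord i ∘ₗ L.dualComp n)
  have hx : x ∈ L.chains M n := Submodule.sum_mem _ fun i _ =>
    ⟨f (c i) ⊗ₜ ⟨c.coord i ∘ₗ L.dualComp n, mem_codualPart.2 (comp_dualComp_mem _)⟩, rfl⟩
  refine ⟨x, hx, supported_ext (toHom_mem hx) hf fun α hα => ?_⟩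
  simp only [x, map_sum, LinearMap.sum_apply, toHom_tmul, LinearMap.comp_apply]
  lift α to degPart L.dualRel n using hα
  simp only [dualComp_of_mem, ← map_smul, ← map_sum, Module.Basis.coord_apply]
  conv_rhs => rw [← c.sum_repr α]
  simp only [Submodule.coe_sum, Submodule.coe_smul, map_sum, map_smul]

theorem mem_chains_iff [FiniteDimensional K E] {M : Type u} [AddCommGroup M] [Module K M] {n : ℕ}
    {x : M ⊗[K] Module.Dual K L.KDual} :
    x ∈ L.chains M n ↔ L.toHom M x ∈ L.supported K M n := by
  refine ⟨toHom_mem, fun h => ?_⟩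
  obtain ⟨y, hy, e⟩ := exists_toHom_eq h
  rwa [← L.toHom_injective e]

end Chains

/-! ### The Koszul operator -/

section Koszul

variable {ι : Type*} [Fintype ι] (b : Module.Basis ι K E) {M : Type*} [AddCommGroup M] [Module K M]

/-- The operator `f ↦ ∑ ρ(x^λ) f(ω_λ ·)` on `Hom(𝒜^!, M)`. -/
def koszulOp (ρ : E → Module.End K M) : (L.KDual →ₗ[K] M) →ₗ[K] L.KDual →ₗ[K] M :=
  ∑ i, LinearMap.compRight K (ρ (b i)) ∘ₗ LinearMap.lcomp K M (L.mulGen (b.coord i))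

variable {L}

theorem koszulOp_apply (ρ : E → Module.End K M) (f : L.KDual →ₗ[K] M) (α : L.KDual) :
    L.koszulOp b ρ f α = ∑ i, ρ (b i) (f (L.mulGen (b.coord i) α)) := by
  simp [koszulOp, LinearMap.sum_apply]

/-- The Koszul operator does not depend on the basis. -/
theorem koszulOp_basis {ι' : Type*} [Fintype ι'] (b' : Module.Basis ι' K E)
    (ρ : E →ₗ[K] Module.End K M) : L.koszulOp b ρ = L.koszulOp b' ρ := by
  refine LinearMap.ext fun f => LinearMap.ext fun α => ?_
  rw [koszulOp_apply, koszulOp_apply]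
  have h1 : ∀ i, f (L.mulGen (b.coord i) α) =
      ∑ j, b.coord i (b' j) • f (L.mulGen (b'.coord j) α) := by
    intro i
    let F : Module.Dual K E →ₗ[K] M := f ∘ₗ LinearMap.mulRight K α ∘ₗ gen L.dualRel
    exact (sum_dual_apply_smul b' F (b.coord i)).symm
  simp only [h1, map_sum, map_smul]
  rw [Finset.sum_comm]
  refine Finset.sum_congr rfl fun j _ => ?_
  have h2 := congrArg (fun x => ρ x (f (L.mulGen (b'.coord j) α))) (b.sum_repr (b' j))
  simpa only [map_sum, map_smul, LinearMap.sum_apply, LinearMap.smul_apply,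
    Module.Basis.coord_apply] using h2

theorem toHom_contract {M : Type u} [AddCommGroup M] [Module K M] (ρ : E → Module.End K M)
    (x : M ⊗[K] Module.Dual K L.KDual) :
    L.toHom M (L.contract b ρ x) = L.koszulOp b ρ (L.toHom M x) := by
  induction x using TensorProduct.induction_on with
  | zero => simp
  | tmul m ξ =>
    refine LinearMap.ext fun α => ?_
    simp [contract, koszulOp_apply, LinearMap.sum_apply, toHom_tmul]
  | add x y hx hy => simp only [map_add, hx, hy]

theorem mulGen_mem {n : ℕ} (ω : Module.Dual K E) {α : L.KDual} (hα : α ∈ degPart L.dualRel n) :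
    L.mulGen ω α ∈ degPart L.dualRel (n + 1) := gen_mul_mem ω hα

theorem koszulOp_mem {S : Type*} [Ring S] [Module S M] [SMulCommClass K S M]
    (ρ : E → Module.End K M) {n : ℕ} {f : L.KDual →ₗ[K] M}
    (hf : f ∈ L.supported S M (n + 1)) : L.koszulOp b ρ f ∈ L.supported S M n := by
  intro m hm α hα
  rw [koszulOp_apply]
  refine Finset.sum_eq_zero fun i _ => ?_
  rw [hf (m + 1) (by omega) _ (mulGen_mem _ hα), map_zero]

theorem koszulOp_eq_zero {S : Type*} [Ring S] [Module S M] [SMulCommClass K S M]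
    (ρ : E → Module.End K M) {f : L.KDual →ₗ[K] M}
    (hf : f ∈ L.supported S M 0) : L.koszulOp b ρ f = 0 := by
  refine ext_degPart fun n α hα => ?_
  rw [koszulOp_apply]
  refine Finset.sum_eq_zero fun i _ => ?_
  rw [hf (n + 1) (by omega) _ (mulGen_mem _ hα), map_zero]

/-- Acyclicity of the Koszul complex of the quadratic part, in terms of linear maps. -/
theorem IsKoszul.exists_koszulOp_eq [FiniteDimensional K E] (h : L.IsKoszul) {n : ℕ}
    {z : L.KDual →ₗ[K] L.Quad} (hz : z ∈ L.supported K L.Quad (n + 1))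
    (hz0 : L.koszulOp b (fun x => LinearMap.mulRight K (gen L.quadRel x)) z = 0) :
    ∃ y ∈ L.supported K L.Quad (n + 2),
      L.koszulOp b (fun x => LinearMap.mulRight K (gen L.quadRel x)) y = z := by
  have hb := koszulOp_basis (L := L) b (Module.finBasis K E)
    ((LinearMap.mul K L.Quad).flip ∘ₗ gen L.quadRel)
  change L.koszulOp b (fun x => LinearMap.mulRight K (gen L.quadRel x)) =
    L.koszulOp _ (fun x => LinearMap.mulRight K (gen L.quadRel x)) at hb
  rw [hb] at hz0 ⊢
  obtain ⟨x, hx, rfl⟩ := exists_toHom_eq hz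
  rw [← toHom_contract, ← map_zero (L.toHom L.Quad)] at hz0
  have hx0 := L.toHom_injective hz0
  obtain ⟨y, hy, e⟩ := Homol.exists_of_subsingleton (h n) hx hx0
  exact ⟨L.toHom _ y, toHom_mem hy, by rw [← toHom_contract]; exact congrArg _ e⟩

end Koszul

/-! ### The Koszul resolution of the trivial module over the enveloping algebra -/

section Resolution

variable {ι : Type*} [Fintype ι] (b : Module.Basis ι K E)

/-- The differential `f ↦ ∑ f(ω_λ ·) x^λ + f ∘ δ` on `Hom(𝒜^!, 𝔄)`. -/
def resD (δ : L.KDual →ₗ[K] L.KDual) : (L.KDual →ₗ[K] L.Env) →ₗ[L.Env] L.KDual →ₗ[K] L.Env where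
  toFun f := L.koszulOp b (fun x => LinearMap.mulRight K (gen L.envRel x)) f + f ∘ₗ δ
  map_add' f g := by rw [map_add, LinearMap.add_comp]; abel
  map_smul' a f := by
    refine LinearMap.ext fun α => ?_
    simp [koszulOp_apply, Finset.mul_sum, mul_assoc]

/-- Evaluation at `α` on `Hom(𝒜^!_n, 𝔄)`. -/
def evalAt (n : ℕ) (α : L.KDual) : L.supported L.Env L.Env n →ₗ[L.Env] L.Env where
  toFun f := f.1 α
  map_add' _ _ := rfl
  map_smul' _ _ := rfl

variable {L}

theorem resD_apply (δ : L.KDual →ₗ[K] L.KDual) (f : L.KDual →ₗ[K] L.Env) (α : L.KDual) :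
    L.resD b δ f α = ∑ i, f (L.mulGen (b.coord i) α) * gen L.envRel (b i) + f (δ α) := by
  change L.koszulOp b (fun x => LinearMap.mulRight K (gen L.envRel x)) f α + f (δ α) = _
  rw [koszulOp_apply]
  rfl

theorem comp_mem_of_degree {M S : Type*} [AddCommGroup M] [Module K M] [Ring S] [Module S M]
    [SMulCommClass K S M] {δ : L.KDual →ₗ[K] L.KDual}
    (hδ : ∀ n, (degPart L.dualRel n).map δ ≤ degPart L.dualRel (n + 1)) {n : ℕ}
    {f : L.KDual →ₗ[K] M} (hf : f ∈ L.supported S M (n + 1)) : f ∘ₗ δ ∈ L.supported S M n :=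
  fun m hm α hα => hf (m + 1) (by omega) _ (hδ m ⟨α, hα, rfl⟩)

theorem resD_mem {δ : L.KDual →ₗ[K] L.KDual}
    (hδ : ∀ n, (degPart L.dualRel n).map δ ≤ degPart L.dualRel (n + 1)) {n : ℕ}
    {f : L.KDual →ₗ[K] L.Env} (hf : f ∈ L.supported L.Env L.Env (n + 1)) :
    L.resD b δ f ∈ L.supported L.Env L.Env n :=
  add_mem (koszulOp_mem b _ hf) (comp_mem_of_degree hδ hf)

variable [FiniteDimensional K E]

/-- The differential has square zero by the identity `sum_tmul_add_sum_tmul_eq_zero`. -/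
theorem resD_resD (h : L.HasPBW) (f : L.KDual →ₗ[K] L.Env) :
    L.resD b (differential h) (L.resD b (differential h) f) = 0 := by
  refine LinearMap.ext fun α => ?_
  let B : L.Env →ₗ[K] L.KDual →ₗ[K] L.Env :=
    LinearMap.mk₂ K (fun a β => f (β * α) * a)
      (fun a a' β => mul_add _ _ _)
      (fun c a β => mul_smul_comm _ _ _)
      (fun a β β' => by rw [add_mul, map_add, add_mul])
      (fun c a β => by rw [smul_mul_assoc, map_smul, smul_mul_assoc])
  have key := sum_apply_add_sum_apply_eq_zero b B
  simp only [B, LinearMap.mk₂_apply, ← differential_coord_mul b h, map_add, add_mul,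
    Finset.sum_add_distrib] at key
  simp only [resD_apply, LinearMap.zero_apply, differential_differential, map_zero, add_zero,
    add_mul, Finset.sum_add_distrib, Finset.sum_mul]
  rw [Finset.sum_comm] at key
  rw [← key, add_assoc]
  congr 1
  simp only [mulGen, LinearMap.mulLeft_apply, mul_assoc]

omit [FiniteDimensional K E] in
/-- Consequences in `𝔄` of the homogeneous relations of the quadratic part hold up to terms of
lower degree. -/
theorem proj_env_tcomp_mem {t : TensorAlgebra K E} (ht : proj L.quadRel t = 0) (k : ℕ) :
    proj L.envRel (tcomp k t) ∈ filtLT L.envRel k := by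
  refine map_tcomp_mem_of_proj_eq_zero (proj L.envRel) (filtLT L.envRel)
    (fun k x a ha => gen_mul_mem_filtLT x ha) (fun k x a ha => mul_gen_mem_filtLT x ha) ?_ ht k
  rintro _ ⟨r, hr, rfl⟩ k
  by_cases h : 2 = k
  · subst h
    rw [tcomp_of_mem (sq_mem r), L.proj_env_sq ⟨r, hr⟩]
    exact degPart_le_filtLT one_lt_two (gen_mem _)
  · rw [tcomp_of_mem_ne (sq_mem r) h, map_zero]; exact zero_mem _

omit [FiniteDimensional K E] in
theorem map_koszulOp {A B : Type*} [Ring A] [Algebra K A] [Ring B] [Algebra K B] (p : A →ₐ[K] B)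
    (g : E → A) (f : L.KDual →ₗ[K] A) (α : L.KDual) :
    p (L.koszulOp b (fun x => LinearMap.mulRight K (g x)) f α) =
      ∑ i, p (f (L.mulGen (b.coord i) α)) * p (g (b i)) := by
  rw [koszulOp_apply, map_sum]
  simp only [LinearMap.mulRight_apply, map_mul]

/-- Cycles of positive degree are boundaries, by induction on the filtration degree: by the
Poincaré–Birkhoff–Witt property the leading term of a cycle is a cycle of the Koszul complex of
the quadratic part, hence a boundary there, and subtracting a lift of this boundary lowers the
filtration degree. -/
theorem exists_resD_eq_of_mem_filtLT (h : L.HasPBW) (hK : L.IsKoszul) {n : ℕ} (p : ℕ) :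
    ∀ z ∈ L.supported L.Env L.Env (n + 1), (∀ α, z α ∈ filtLT L.envRel p) →
      L.resD b (differential h) z = 0 →
      ∃ y ∈ L.supported L.Env L.Env (n + 2), L.resD b (differential h) y = z := by
  induction p with
  | zero =>
    intro z _ hp _
    refine ⟨0, zero_mem _, ?_⟩
    rw [map_zero, eq_comm]
    exact LinearMap.ext fun α => (Submodule.mem_bot K).1 (filtLT_zero L.envRel ▸ hp α)
  | succ p ih =>
    intro z hz hp hd
    obtain ⟨s, hs⟩ := exists_leadingTerm L.envRel p
    -- the leading term of `z`
    let zp : L.KDual →ₗ[K] TensorAlgebra K E := s ∘ₗ z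
    have hzp : ∀ α, zp α ∈ tpow K E p := fun α => (hs _ (hp α)).1
    have hlow : ∀ α, z α - proj L.envRel (zp α) ∈ filtLT L.envRel p := by
      intro α
      obtain ⟨c, hc, e⟩ := (hs _ (hp α)).2
      have e' : z α - proj L.envRel (zp α) = c := sub_eq_of_eq_add e
      rwa [e']
    let kT := L.koszulOp b (fun x => LinearMap.mulRight K (TensorAlgebra.ι K x))
    -- the leading term of `z` is a Koszul cycle over the quadratic part
    have hcyc : ∀ α, proj L.quadRel (kT zp α) = 0 := by
      intro α
      refine h (p + 1) _ ?_ ?_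
      · rw [koszulOp_apply, pow_succ]
        exact Submodule.sum_mem _ fun i _ => Submodule.mul_mem_mul (hzp _) ⟨_, rfl⟩
      · have h1 := LinearMap.congr_fun hd α
        rw [resD_apply, LinearMap.zero_apply] at h1
        have h2 : proj L.envRel (kT zp α) = -(∑ i, (z (L.mulGen (b.coord i) α) -
            proj L.envRel (zp (L.mulGen (b.coord i) α))) * gen L.envRel (b i) +
              z (differential h α)) := by
          rw [map_koszulOp, eq_neg_iff_add_eq_zero, ← h1, ← add_assoc, ← Finset.sum_add_distrib]
          congr 1
          refine Finset.sum_congr rfl fun i _ => ?_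
          rw [proj_ι, ← add_mul, add_sub_cancel]
        rw [h2]
        exact neg_mem (add_mem (Submodule.sum_mem _ fun i _ => mul_gen_mem_filtLT _ (hlow _))
          (hp _))
    obtain ⟨y₀, hy₀, hy₀'⟩ := hK.exists_koszulOp_eq b
      (z := (proj L.quadRel).toLinearMap ∘ₗ zp)
      (comp_mem_supported (comp_mem_supported (S' := K) hz s) _) (by
        refine LinearMap.ext fun α => ?_
        rw [LinearMap.zero_apply, ← hcyc α, map_koszulOp, koszulOp_apply]
        rfl)
    -- only the tensors of degree `p - 1` of a lift of `y₀` contribute to the leading term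
    let yT : L.KDual →ₗ[K] TensorAlgebra K E := tcompPred p ∘ₗ lift L.quadRel ∘ₗ y₀
    let y₁ : L.KDual →ₗ[K] L.Env := (proj L.envRel).toLinearMap ∘ₗ yT
    have hy₁ : y₁ ∈ L.supported L.Env L.Env (n + 2) :=
      comp_mem_supported (comp_mem_supported (S' := K) (comp_mem_supported (S' := K) hy₀ _) _) _
    have hmid : ∀ α, proj L.envRel (zp α - kT yT α) ∈ filtLT L.envRel p := by
      intro α
      have h1 : proj L.quadRel (zp α - kT (lift L.quadRel ∘ₗ y₀) α) = 0 := by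
        rw [map_sub, map_koszulOp, sub_eq_zero]
        refine (LinearMap.congr_fun hy₀' α).symm.trans ?_
        rw [koszulOp_apply]
        refine Finset.sum_congr rfl fun i _ => ?_
        rw [LinearMap.comp_apply, proj_lift, proj_ι]
        rfl
      have h2 := proj_env_tcomp_mem h1 p
      rw [map_sub, tcomp_of_mem (hzp α), koszulOp_apply, map_sum] at h2
      simp only [LinearMap.mulRight_apply, tcomp_mul_ι] at h2
      rw [koszulOp_apply]
      exact h2
    let z₁ : L.KDual →ₗ[K] L.Env := z - L.resD b (differential h) y₁
    have hz₁ : L.resD b (differential h) y₁ + z₁ = z :=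
      LinearMap.ext fun α => add_sub_cancel (L.resD b (differential h) y₁ α) (z α)
    have hDy := resD_mem b (differential_degree h) hy₁
    obtain ⟨y₂, hy₂, hy₂'⟩ := ih z₁
      (fun m hm α hα => by rw [LinearMap.sub_apply, hz m hm α hα, hDy m hm α hα, sub_zero])
      (fun α => by
        have : z₁ α = (z α - proj L.envRel (zp α)) +
            proj L.envRel (zp α - kT yT α) - y₁ (differential h α) := by
          rw [LinearMap.sub_apply, resD_apply, map_sub, map_koszulOp]
          simp only [proj_ι]
          change _ - (∑ i, proj L.envRel (yT (L.mulGen (b.coord i) α)) * _ + _) = _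
          abel
        rw [this]
        exact sub_mem (add_mem (hlow α) (hmid α)) (proj_tcompPred_mem _ _ _))
      (by
        have := map_add (L.resD b (differential h)) (L.resD b (differential h) y₁) z₁
        rw [hz₁, hd, resD_resD, zero_add] at this
        exact this.symm)
    exact ⟨y₁ + y₂, add_mem hy₁ hy₂, by rw [map_add, hy₂', hz₁]⟩

/-- Exactness of the resolution in positive degrees. Since `𝒜^!` is finite-dimensional in each
degree, the values of a cycle have bounded filtration degree. -/
theorem exists_resD_eq (h : L.HasPBW) (hK : L.IsKoszul) {n : ℕ} {z : L.KDual →ₗ[K] L.Env}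
    (hz : z ∈ L.supported L.Env L.Env (n + 1)) (hd : L.resD b (differential h) z = 0) :
    ∃ y ∈ L.supported L.Env L.Env (n + 2), L.resD b (differential h) y = z := by
  obtain ⟨p, hp⟩ := exists_mem_filtLT_of_fg (S := L.envRel)
    (N := (degPart L.dualRel (n + 1)).map z)
    (Submodule.FG.map _ (Module.Finite.iff_fg.1 inferInstance))
  refine exists_resD_eq_of_mem_filtLT b h hK p z hz (fun α => ?_) hd
  have : ⊤ ≤ (filtLT L.envRel p).comap z := by
    rw [← iSup_degPart]
    refine iSup_le fun m α hα => ?_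
    by_cases hm : m = n + 1
    · subst hm; exact hp ⟨α, hα, rfl⟩
    · rw [Submodule.mem_comap, hz m hm α hα]; exact zero_mem _
  exact this (Submodule.mem_top (x := α))

/-! ### The augmentation -/

omit [FiniteDimensional K E] in
theorem envAug_gen (x : E) : L.envAug (gen L.envRel x) = 0 := by
  have : L.envAug (proj L.envRel (TensorAlgebra.ι K x)) = TensorAlgebra.algebraMapInv _ :=
    RingQuot.liftAlgHom_mkAlgHom_apply ..
  rw [← proj_ι, this]
  simp [TensorAlgebra.algebraMapInv]

omit [FiniteDimensional K E] in
/-- The augmentation ideal of `𝔄` is the left ideal generated by `E`. -/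
theorem exists_eq_algebraMap_add (a : L.Env) : ∃ c : ι → L.Env,
    a = algebraMap K _ (L.envAug a) + ∑ i, c i * gen L.envRel (b i) := by
  obtain ⟨t, rfl⟩ := proj_surjective _ a
  induction t using TensorAlgebra.induction with
  | algebraMap r => exact ⟨0, by simp [AlgHom.commutes]⟩
  | ι x =>
    refine ⟨fun i => algebraMap K _ (b.repr x i), ?_⟩
    rw [proj_ι, envAug_gen, map_zero, zero_add]
    conv_lhs => rw [← b.sum_repr x]
    simp only [map_sum, map_smul, Algebra.smul_def]
  | mul s t hs ht =>
    obtain ⟨c, hc⟩ := hs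
    obtain ⟨d, hd⟩ := ht
    refine ⟨fun i => algebraMap K _ (L.envAug (proj _ t)) * c i + proj _ s * d i, ?_⟩
    rw [map_mul, map_mul]
    conv_lhs => rw [hd, mul_add, ← Algebra.commutes]
    simp only [add_mul, Finset.sum_add_distrib, mul_assoc, ← Finset.mul_sum]
    rw [mul_comm, map_mul, ← add_assoc, ← mul_add, ← hc]
  | add s t hs ht =>
    obtain ⟨c, hc⟩ := hs
    obtain ⟨d, hd⟩ := ht
    refine ⟨c + d, ?_⟩
    rw [map_add, map_add, map_add]
    conv_lhs => rw [hc, hd]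
    simp only [Pi.add_apply, add_mul, Finset.sum_add_distrib]
    abel

variable (L) in
/-- The coordinate of degree one of an element of the Koszul dual. -/
def dualCoordOne : L.KDual →ₗ[K] Module.Dual K E := coordOne L.perp

omit [FiniteDimensional K E] in
theorem dualCoordOne_gen (ω : Module.Dual K E) : L.dualCoordOne (gen L.dualRel ω) = ω :=
  coordOne_gen (R := L.perp) ω

/-- Exactness of the resolution in degree zero. -/
theorem exists_resD_eq_zero (h : L.HasPBW) {z : L.KDual →ₗ[K] L.Env}
    (hz : z ∈ L.supported L.Env L.Env 0) (h0 : L.envAug (z 1) = 0) :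
    ∃ y ∈ L.supported L.Env L.Env 1, L.resD b (differential h) y = z := by
  classical
  obtain ⟨c, hc⟩ := exists_eq_algebraMap_add b (z 1)
  rw [h0, map_zero, zero_add] at hc
  let y : L.KDual →ₗ[K] L.Env := (b.dualBasis.constr K c ∘ₗ L.dualCoordOne ∘ₗ
    (degPart L.dualRel 1).subtype) ∘ₗ L.dualComp 1
  have hy : y ∈ L.supported L.Env L.Env 1 := comp_dualComp_mem _
  have hyg : ∀ i, y (gen L.dualRel (b.coord i)) = c i := by
    intro i
    have : L.dualComp 1 (gen L.dualRel (b.coord i)) = ⟨_, gen_mem _⟩ :=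
      dualComp_of_mem ⟨_, gen_mem _⟩
    simp only [y, LinearMap.comp_apply, this, Submodule.subtype_apply]
    rw [dualCoordOne_gen, ← b.coe_dualBasis, Module.Basis.constr_basis]
  refine ⟨y, hy, supported_ext (resD_mem b
    (differential_degree h) hy) hz fun α hα => ?_⟩
  obtain ⟨k, rfl⟩ := mem_degPart_zero hα
  rw [Algebra.algebraMap_eq_smul_one, map_smul, map_smul, hc, resD_apply]
  have : differential h 1 = 0 := by
    rw [← map_one (algebraMap K L.KDual), differential_algebraMap]
  simp [this, mulGen, hyg]

theorem envAug_resD (h : L.HasPBW) (f : L.KDual →ₗ[K] L.Env) :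
    L.envAug (L.resD b (differential h) f 1) = 0 := by
  have : differential h 1 = 0 := by
    rw [← map_one (algebraMap K L.KDual), differential_algebraMap]
  rw [resD_apply, this, map_zero, add_zero, map_sum]
  exact Finset.sum_eq_zero fun i _ => by rw [map_mul, envAug_gen, mul_zero]

omit [FiniteDimensional K E] in
/-- Evaluation at `1` is onto, hence so is the augmentation of the resolution. -/
theorem exists_supported_zero (a : L.Env) : ∃ f ∈ L.supported L.Env L.Env 0, f 1 = a := by
  refine ⟨(LinearMap.toSpanSingleton K L.Env a ∘ₗ
    (aug L.dualRel (by rintro _ ⟨t, -, rfl⟩; exact algebraMapInv_sq t)).toLinearMap ∘ₗ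
    (degPart L.dualRel 0).subtype) ∘ₗ L.dualComp 0, comp_dualComp_mem _, ?_⟩
  have : L.dualComp 0 1 = ⟨1, one_mem_degPart⟩ := dualComp_of_mem ⟨1, one_mem_degPart⟩
  simp [LinearMap.comp_apply, this]

end Resolution

end Prealgebra

/-! ### Homological algebra of modules -/

namespace CategoryTheory.ProjectiveResolution

variable {A : Type u} [Ring A] (X : ℕ → ModuleCat.{u} A) (d : ∀ n, X (n + 1) ⟶ X n)
  {Z : ModuleCat.{u} A} (ε : X 0 ⟶ Z)

theorem _root_.ChainComplex.of_d_succ (sq : ∀ n, d (n + 1) ≫ d n = 0) (n : ℕ) :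
    (ChainComplex.of X d sq).d (n + 1) n = d n := ChainComplex.of_d ..

/-- The augmentation of a chain complex given by `ε : X 0 → Z`. -/
def _root_.ChainComplex.ofAugmentation (sq : ∀ n, d (n + 1) ≫ d n = 0) (hε : d 0 ≫ ε = 0) :
    ChainComplex.of X d sq ⟶ (ChainComplex.single₀ _).obj Z :=
  (ChainComplex.toSingle₀Equiv _ _).symm
    ⟨ε, (congrArg (· ≫ ε) (ChainComplex.of_d_succ X d sq 0)).trans hε⟩

theorem _root_.ChainComplex.ofAugmentation_f_zero (sq : ∀ n, d (n + 1) ≫ d n = 0)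
    (hε : d 0 ≫ ε = 0) :
    (ChainComplex.ofAugmentation X d ε sq hε).f 0 = ε :=
  ChainComplex.toSingle₀Equiv_symm_apply_f_zero _ _

/-- An exact sequence `⋯ → X 1 → X 0 → Z → 0` of modules with projective `X n`, as a projective
resolution of `Z`. -/
def ofExact (hX : ∀ n, Projective (X n)) (sq : ∀ n, d (n + 1) ≫ d n = 0)
    (hε : d 0 ≫ ε = 0) (hsurj : Function.Surjective ε.hom)
    (h0 : ∀ x, ε.hom x = 0 → ∃ y, (d 0).hom y = x)
    (hd : ∀ n x, (d n).hom x = 0 → ∃ y, (d (n + 1)).hom y = x) : ProjectiveResolution Z where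
  complex := ChainComplex.of X d sq
  projective := hX
  π := ChainComplex.ofAugmentation X d ε sq hε
  quasiIso := ⟨fun n => by
    have hdn : ∀ n y, ((ChainComplex.of X d sq).d (n + 1) n).hom y = (d n).hom y :=
      fun n y => by rw [ChainComplex.of_d_succ]
    have hπ : ∀ x, ((ChainComplex.ofAugmentation X d ε sq hε).f 0).hom x = ε.hom x :=
      fun x => by rw [ChainComplex.ofAugmentation_f_zero]; rfl
    cases n with
    | zero =>
      rw [ChainComplex.quasiIsoAt₀_iff, ShortComplex.quasiIso_iff_of_zeros' _ rfl rfl rfl]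
      constructor
      · rw [ShortComplex.moduleCat_exact_iff]
        intro x hx
        obtain ⟨y, hy⟩ := h0 x ((hπ x).symm.trans hx)
        exact ⟨y, (hdn 0 y).trans hy⟩
      · rw [ModuleCat.epi_iff_surjective]
        intro z
        obtain ⟨x, hx⟩ := hsurj z
        exact ⟨x, (hπ x).trans hx⟩
    | succ n =>
      rw [quasiIsoAt_iff_exactAt' (hL := ChainComplex.exactAt_succ_single_obj ..),
        HomologicalComplex.exactAt_iff' _ (n + 2) (n + 1) n (by simp) (by simp),
        ShortComplex.moduleCat_exact_iff]
      intro x hx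
      obtain ⟨y, hy⟩ := hd n x ((hdn n x).symm.trans hx)
      exact ⟨y, (hdn (n + 1) y).trans hy⟩⟩

end CategoryTheory.ProjectiveResolution

/-! ### Cohomology of the dual of a projective resolution -/

namespace CategoryTheory.ProjectiveResolution

open Abelian

section

variable {C : Type*} [Category C] [Abelian C] [HasExt.{u} C] {X Y : C}

theorem extMk_zero_eq_zero_iff (R : ProjectiveResolution X) (f : R.complex.X 0 ⟶ Y)
    (hf : R.complex.d 1 0 ≫ f = 0) : R.extMk f 1 rfl hf = 0 ↔ f = 0 := by
  refine ⟨fun h => ?_, ?_⟩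
  · rw [← R.extEquivCohomologyClass.apply_eq_iff_eq, extEquivCohomologyClass_extMk,
      extEquivCohomologyClass_zero, CochainComplex.HomComplex.CohomologyClass.mk_eq_zero_iff,
      CochainComplex.HomComplex.Cocycle.toSingleMk_mem_coboundaries_iff _ _ _ _ _ 1 (by simp)] at h
    obtain ⟨g, hg⟩ := h
    -- the complex is zero in cohomological degree one
    have hz : Limits.IsZero (R.cochainComplex.X 1) :=
      CochainComplex.isZero_of_isStrictlyLE _ 0 _ (by norm_num)
    rw [hz.eq_of_src g 0, Limits.comp_zero] at hg
    rw [← cancel_epi (R.cochainComplexXIso (-(0 : ℕ)) 0 rfl).hom, ← hg, Limits.comp_zero]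
  · rintro rfl
    exact R.extMk_zero 1 rfl

end

variable {K : Type u} [Field K]

/-- A family of morphisms of `A`-modules which depends `K`-linearly on a parameter. The space of
morphisms carries the `K`-module structure of the linear category of `A`-modules, for which `K` acts
on modules through `A`. -/
def _root_.ModuleCat.linearFamily {A : Type u} [Ring A] [Algebra K A] {X Y : ModuleCat.{u} A}
    {M : Type u} [AddCommGroup M] [Module K M] (f : M → X →ₗ[A] Y)
    (hadd : ∀ m m' x, f (m + m') x = f m x + f m' x)
    (hsmul : ∀ (c : K) m x, f (c • m) x = algebraMap K A c • f m x) : M →ₗ[K] (X ⟶ Y) where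
  toFun m := ModuleCat.ofHom (f m)
  map_add' m m' := ModuleCat.hom_ext (LinearMap.ext fun x => hadd m m' x)
  map_smul' c m := ModuleCat.hom_ext (LinearMap.ext fun x => hsmul c m x)

section Ext

variable {A : Type u} [Ring A] [Algebra K A] {X Y : ModuleCat.{u} A} (R : ProjectiveResolution X)
  {M : Type u} [AddCommGroup M] [Module K M] {d : M →ₗ[K] M} {P : ℕ → Submodule K M}
  (ψ : ∀ n, P n →ₗ[K] (R.complex.X n ⟶ Y)) (hd : ∀ n, ∀ z ∈ P n, d z ∈ P (n + 1))
  (hψ : ∀ n (z : P n), ψ (n + 1) ⟨d z, hd n z z.2⟩ = R.complex.d (n + 1) n ≫ ψ n z)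

include hψ in
theorem d_comp_eq_zero (n : ℕ) (z : cycles d (P n)) :
    R.complex.d (n + 1) n ≫ ψ n ⟨z, z.2.1⟩ = 0 := by
  rw [← hψ, ← map_zero (ψ (n + 1))]
  exact congrArg _ (Subtype.ext z.2.2)

/-- The class in `Ext` of a cocycle of a complex `(M, d)` with a morphism `ψ` to the complex
`Hom(R, Y)`. -/
def extClass (n : ℕ) : cycles d (P n) →ₗ[K] Ext X Y n where
  toFun z := R.extMk (ψ n ⟨z, z.2.1⟩) (n + 1) rfl (R.d_comp_eq_zero ψ hd hψ n z)
  map_add' z w := by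
    rw [R.add_extMk]
    congr 1
    rw [← map_add]
    rfl
  map_smul' c z := by
    rw [RingHom.id_apply, Ext.smul_eq_comp_mk₀, R.extMk_comp_mk₀]
    congr 1
    rw [Linear.comp_smul, Category.comp_id, ← map_smul]
    rfl

theorem ker_extClass (hbij : ∀ n, Function.Bijective (ψ n)) (n : ℕ) :
    ((⨆ (m : ℕ) (_ : m + 1 = n), P m).map d).submoduleOf (cycles d (P n)) =
      LinearMap.ker (R.extClass ψ hd hψ n) := by
  ext z
  change (z : M) ∈ (⨆ (m : ℕ) (_ : m + 1 = n), P m).map d ↔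
    R.extMk (ψ n ⟨z, z.2.1⟩) (n + 1) rfl (R.d_comp_eq_zero ψ hd hψ n z) = 0
  cases n with
  | zero =>
    have hbot : (⨆ (m : ℕ) (_ : m + 1 = 0), P m) = ⊥ := by simp
    rw [R.extMk_zero_eq_zero_iff, map_eq_zero_iff _ (hbij 0).1, hbot, Submodule.map_bot,
      Submodule.mem_bot]
    exact ⟨fun h => Subtype.ext h, congrArg Subtype.val⟩
  | succ n =>
    rw [R.extMk_eq_zero_iff _ _ _ _ n rfl]
    simp only [Nat.add_right_cancel_iff, iSup_iSup_eq_left, Submodule.mem_map]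
    constructor
    · rintro ⟨y, hy, e⟩
      exact ⟨ψ n ⟨y, hy⟩, by rw [← hψ]; congr 1; exact Subtype.ext e⟩
    · rintro ⟨g, hg⟩
      obtain ⟨y, rfl⟩ := (hbij n).2 g
      rw [← hψ] at hg
      exact ⟨y, y.2, congrArg Subtype.val ((hbij _).1 hg)⟩

theorem extClass_surjective (hbij : ∀ n, Function.Bijective (ψ n)) (n : ℕ) :
    Function.Surjective (R.extClass ψ hd hψ n) := by
  intro x
  obtain ⟨f, hf, rfl⟩ := R.extMk_surjective x (n + 1) rfl
  obtain ⟨z, rfl⟩ := (hbij n).2 f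
  rw [← hψ, ← map_zero (ψ (n + 1))] at hf
  exact ⟨⟨z, z.2, congrArg Subtype.val ((hbij _).1 hf)⟩, rfl⟩

/-- When `ψ` is an isomorphism of complexes, the cohomology of `(M, d)` is `Ext`. -/
def extEquiv (hbij : ∀ n, Function.Bijective (ψ n)) (n : ℕ) :
    Homol d (P n) (⨆ (m : ℕ) (_ : m + 1 = n), P m) ≃ₗ[K] Ext X Y n :=
  (Submodule.quotEquivOfEq _ _ (R.ker_extClass ψ hd hψ hbij n)).trans
    ((R.extClass ψ hd hψ n).quotKerEquivOfSurjective (R.extClass_surjective ψ hd hψ hbij n))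

theorem extEquiv_cls_comp (hbij : ∀ n, Function.Bijective (ψ n))
    {Y' : ModuleCat.{u} A} {M' : Type u} [AddCommGroup M'] [Module K M'] {d' : M' →ₗ[K] M'}
    {P' : ℕ → Submodule K M'} (ψ' : ∀ n, P' n →ₗ[K] (R.complex.X n ⟶ Y'))
    (hd' : ∀ n, ∀ z ∈ P' n, d' z ∈ P' (n + 1))
    (hψ' : ∀ n (z : P' n), ψ' (n + 1) ⟨d' z, hd' n z z.2⟩ = R.complex.d (n + 1) n ≫ ψ' n z)
    (hbij' : ∀ n, Function.Bijective (ψ' n)) (n : ℕ) (g : Y ⟶ Y')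
    (z : cycles d (P n)) (z' : cycles d' (P' n))
    (e : ψ' n ⟨z', z'.2.1⟩ = ψ n ⟨z, z.2.1⟩ ≫ g) :
    R.extEquiv ψ' hd' hψ' hbij' n (Homol.cls d' (P' n) _ z') =
      (R.extEquiv ψ hd hψ hbij n (Homol.cls d (P n) _ z)).comp (Ext.mk₀ g) (add_zero n) := by
  change R.extMk (ψ' n ⟨z', z'.2.1⟩) (n + 1) rfl (R.d_comp_eq_zero ψ' hd' hψ' n z') =
    (R.extMk (ψ n ⟨z, z.2.1⟩) (n + 1) rfl (R.d_comp_eq_zero ψ hd hψ n z)).comp _ _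
  rw [R.extMk_comp_mk₀]
  congr 1

end Ext

end CategoryTheory.ProjectiveResolution

/-! ### Homology of complexes of vector spaces -/

namespace ChainComplex

variable {K : Type u} [Field K] (G : ChainComplex (ModuleCat.{u} K) ℕ)
  {M : Type u} [AddCommGroup M] [Module K M] {d : M →ₗ[K] M} {P : ℕ → Submodule K M}
  (ψ : ∀ n, P n →ₗ[K] G.X n) (h0 : ∀ z ∈ P 0, d z = 0)
  (hd : ∀ n, ∀ z ∈ P (n + 1), d z ∈ P n)
  (hψ : ∀ n (z : P (n + 1)), ψ n ⟨d z, hd n z z.2⟩ = (G.d (n + 1) n).hom (ψ (n + 1) z))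

include hψ in
theorem comp_d_eq_zero (n : ℕ) :
    ModuleCat.ofHom (ψ n ∘ₗ Submodule.inclusion (inf_le_left : cycles d (P n) ≤ P n)) ≫
      G.d n ((ComplexShape.down ℕ).next n) = 0 := by
  cases n with
  | zero =>
    rw [G.shape, Limits.comp_zero]
    simp
  | succ n =>
    rw [ChainComplex.next_nat_succ]
    ext z
    have h := hψ n ⟨z, z.2.1⟩
    have hz : (⟨d z, hd n z z.2.1⟩ : P n) = 0 := Subtype.ext z.2.2
    rw [hz, map_zero] at h
    exact h.symm

/-- The morphism from the cycles of `(M, d)` to those of `G` given by a morphism of complexes. -/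
def toCyclesMap (n : ℕ) : cycles d (P n) →ₗ[K] G.cycles n :=
  (G.liftCycles (A := ModuleCat.of K (cycles d (P n))) _ _ rfl
    (comp_d_eq_zero G ψ hd hψ n)).hom

theorem iCycles_toCyclesMap (n : ℕ) (z : cycles d (P n)) :
    (G.iCycles n).hom (toCyclesMap G ψ hd hψ n z) = ψ n ⟨z, z.2.1⟩ :=
  LinearMap.congr_fun (congrArg ModuleCat.Hom.hom
    (G.liftCycles_i (A := ModuleCat.of K (cycles d (P n))) _ _ rfl
      (comp_d_eq_zero G ψ hd hψ n))) z

/-- The class in the homology of `G` of a cycle of a complex `(M, d)` with a morphism `ψ` to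
`G`. -/
def homologyClass (n : ℕ) : cycles d (P n) →ₗ[K] G.homology n :=
  (G.homologyπ n).hom ∘ₗ toCyclesMap G ψ hd hψ n

theorem iCycles_injective (n : ℕ) : Function.Injective (G.iCycles n).hom :=
  (ModuleCat.mono_iff_injective _).1 inferInstance

include h0 in
theorem homologyClass_surjective (hbij : ∀ n, Function.Bijective (ψ n)) (n : ℕ) :
    Function.Surjective (homologyClass G ψ hd hψ n) := by
  intro x
  obtain ⟨c, rfl⟩ := (ModuleCat.epi_iff_surjective (G.homologyπ n)).1 inferInstance x
  obtain ⟨z, hz⟩ := (hbij n).2 ((G.iCycles n).hom c)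
  have hdz : d z = 0 := by
    cases n with
    | zero => exact h0 z z.2
    | succ n =>
      have h := hψ n z
      have h' := LinearMap.congr_fun (congrArg ModuleCat.Hom.hom (G.iCycles_d (n + 1) n)) c
      rw [hz, show (G.d (n + 1) n).hom ((G.iCycles (n + 1)).hom c) = 0 from h',
        ← map_zero (ψ n)] at h
      exact congrArg Subtype.val ((hbij n).1 h)
  exact ⟨⟨z, z.2, hdz⟩, congrArg (G.homologyπ n).hom (iCycles_injective G n
    ((iCycles_toCyclesMap G ψ hd hψ n _).trans hz))⟩

theorem ker_homologyClass (hbij : ∀ n, Function.Bijective (ψ n)) (n : ℕ) :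
    ((P (n + 1)).map d).submoduleOf (cycles d (P n)) =
      LinearMap.ker (homologyClass G ψ hd hψ n) := by
  have hex := ShortComplex.exact_of_g_is_cokernel
    (ShortComplex.mk (G.toCycles (n + 1) n) (G.homologyπ n) (G.toCycles_comp_homologyπ _ _))
    (G.homologyIsCokernel (n + 1) n (by simp))
  rw [ShortComplex.moduleCat_exact_iff] at hex
  have hi : ∀ w, (G.iCycles n).hom ((G.toCycles (n + 1) n).hom w) = (G.d (n + 1) n).hom w :=
    fun w => LinearMap.congr_fun (congrArg ModuleCat.Hom.hom (G.toCycles_i (n + 1) n)) w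
  ext z
  change (z : M) ∈ (P (n + 1)).map d ↔
    (G.homologyπ n).hom (toCyclesMap G ψ hd hψ n z) = 0
  constructor
  · rintro ⟨w, hw, e⟩
    have h1 : toCyclesMap G ψ hd hψ n z = (G.toCycles (n + 1) n).hom (ψ (n + 1) ⟨w, hw⟩) :=
      iCycles_injective G n ((iCycles_toCyclesMap G ψ hd hψ n z).trans
        (((congrArg (ψ n) (Subtype.ext e.symm)).trans (hψ n ⟨w, hw⟩)).trans (hi _).symm))
    rw [h1]
    exact LinearMap.congr_fun
      (congrArg ModuleCat.Hom.hom (G.toCycles_comp_homologyπ (n + 1) n)) _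
  · intro h
    obtain ⟨w, hw⟩ := hex _ h
    obtain ⟨w, rfl⟩ := (hbij (n + 1)).2 w
    have h2 := ((hψ n w).trans (hi _).symm).trans ((congrArg (G.iCycles n).hom hw).trans
      (iCycles_toCyclesMap G ψ hd hψ n z))
    exact ⟨w, w.2, congrArg Subtype.val ((hbij n).1 h2)⟩

/-- When `ψ` is an isomorphism of complexes, the homology of `(M, d)` is that of `G`. -/
def homologyEquiv (hbij : ∀ n, Function.Bijective (ψ n)) (n : ℕ) :
    Homol d (P n) (P (n + 1)) ≃ₗ[K] G.homology n :=
  (Submodule.quotEquivOfEq _ _ (ker_homologyClass G ψ hd hψ hbij n)).trans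
    ((homologyClass G ψ hd hψ n).quotKerEquivOfSurjective
      (homologyClass_surjective G ψ h0 hd hψ hbij n))

variable {G}

theorem homologyMap_homologyClass {G' : ChainComplex (ModuleCat.{u} K) ℕ}
    {M' : Type u} [AddCommGroup M'] [Module K M'] {d' : M' →ₗ[K] M'} {P' : ℕ → Submodule K M'}
    (ψ' : ∀ n, P' n →ₗ[K] G'.X n) (hd' : ∀ n, ∀ z ∈ P' (n + 1), d' z ∈ P' n)
    (hψ' : ∀ n (z : P' (n + 1)),
      ψ' n ⟨d' z, hd' n z z.2⟩ = (G'.d (n + 1) n).hom (ψ' (n + 1) z))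
    (f : G ⟶ G') (n : ℕ) (z : cycles d (P n)) (z' : cycles d' (P' n))
    (h : (f.f n).hom (ψ n ⟨z, z.2.1⟩) = ψ' n ⟨z', z'.2.1⟩) :
    (HomologicalComplex.homologyMap f n).hom (homologyClass G ψ hd hψ n z) =
      homologyClass G' ψ' hd' hψ' n z' := by
  have h1 := fun c => LinearMap.congr_fun
    (congrArg ModuleCat.Hom.hom (HomologicalComplex.homologyπ_naturality f n)) c
  have h2 := fun c => LinearMap.congr_fun
    (congrArg ModuleCat.Hom.hom (HomologicalComplex.cyclesMap_i f n)) c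
  refine (h1 _).trans (congrArg (G'.homologyπ n).hom (iCycles_injective G' n ?_))
  exact (h2 _).trans (((congrArg (f.f n).hom (iCycles_toCyclesMap G ψ hd hψ n z)).trans h).trans
    (iCycles_toCyclesMap G' ψ' hd' hψ' n z').symm)

end ChainComplex

namespace Prealgebra

open Presented AugAlg

variable {K E : Type u} [Field K] [AddCommGroup E] [Module K E] (L : Prealgebra K E)

/-! ### The projective resolution of the trivial module -/

section Resolution

variable [FiniteDimensional K E]

/-- A basis of the component of degree `n` of the Koszul dual. -/
abbrev dualPartBasis (n : ℕ) :
    Module.Basis (Fin (Module.finrank K (degPart L.dualRel n))) K (degPart L.dualRel n) :=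
  Module.finBasis K _

/-- Evaluation on a basis of `𝒜^!_n` identifies `Hom(𝒜^!_n, 𝔄)` with a free module. -/
def supportedEquivFun (n : ℕ) : L.supported L.Env L.Env n ≃ₗ[L.Env]
    (Fin (Module.finrank K (degPart L.dualRel n)) → L.Env) where
  toFun f i := f.1 (L.dualPartBasis n i)
  map_add' _ _ := rfl
  map_smul' _ _ := rfl
  invFun a := ⟨(L.dualPartBasis n).constr K a ∘ₗ L.dualComp n, comp_dualComp_mem _⟩
  left_inv f := by
    refine Subtype.ext (supported_ext (comp_dualComp_mem _) f.2 fun α hα => ?_)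
    lift α to degPart L.dualRel n using hα
    rw [LinearMap.comp_apply, dualComp_of_mem]
    refine LinearMap.congr_fun (f := (L.dualPartBasis n).constr K _)
      (g := f.1 ∘ₗ (degPart L.dualRel n).subtype) ((L.dualPartBasis n).ext fun i => ?_) α
    rw [Module.Basis.constr_basis]
    rfl
  right_inv a := by
    funext i
    change (L.dualPartBasis n).constr K a (L.dualComp n (L.dualPartBasis n i)) = a i
    rw [dualComp_of_mem, Module.Basis.constr_basis]

/-- The basis of the left `𝔄`-module `Hom(𝒜^!_n, 𝔄)` dual to the basis of `𝒜^!_n`. -/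
def supportedBasis (n : ℕ) : Module.Basis (Fin (Module.finrank K (degPart L.dualRel n))) L.Env
    (L.supported L.Env L.Env n) :=
  Module.Basis.ofEquivFun (L.supportedEquivFun n)

variable {L} {n : ℕ}

theorem supportedBasis_apply (i) (α : degPart L.dualRel n) :
    (L.supportedBasis n i).1 α = algebraMap K L.Env ((L.dualPartBasis n).coord i α) := by
  classical
  refine LinearMap.congr_fun (f := (L.supportedBasis n i).1 ∘ₗ (degPart L.dualRel n).subtype)
    (g := Algebra.linearMap K L.Env ∘ₗ (L.dualPartBasis n).coord i)
    ((L.dualPartBasis n).ext fun j => ?_) α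
  refine ((L.supportedBasis n).equivFun_self i j).trans ?_
  simp [Finsupp.single_apply, eq_comm]

variable (L n) in
/-- The term `Hom(𝒜^!_n, 𝔄)` of the resolution. -/
abbrev resX : ModuleCat.{u} L.Env := ModuleCat.of L.Env (L.supported L.Env L.Env n)

theorem resX_projective : Projective (L.resX n) := by
  have := Module.Projective.of_basis (L.supportedBasis n)
  exact (IsProjective.iff_projective _).1 this

variable {ι : Type*} [Fintype ι] (b : Module.Basis ι K E) (h : L.HasPBW)

variable (n) in
/-- The differential of the resolution. -/
def resMap : L.resX (n + 1) ⟶ L.resX n :=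
  ModuleCat.ofHom ((L.resD b (differential h)).restrict fun _ =>
    resD_mem b (differential_degree h))

theorem resMap_comp_resMap (n : ℕ) : resMap (n + 1) b h ≫ resMap n b h = 0 :=
  ModuleCat.hom_ext <| LinearMap.ext fun f => Subtype.ext (resD_resD b h f.1)

variable (L) in
/-- The augmentation `f ↦ ε(f(1))` of the resolution. -/
def resAug : L.resX 0 ⟶ L.envTriv :=
  ModuleCat.ofHom (Y := L.envTriv)
    { toFun := fun f => L.envAug (f.1 1)
      map_add' := fun f g => map_add L.envAug (f.1 1) (g.1 1)
      map_smul' := fun a f => map_mul L.envAug a (f.1 1) }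

/-- The resolution of the trivial module by the `Hom(𝒜^!_n, 𝔄)`. -/
def resolution (hK : L.IsKoszul) : ProjectiveResolution L.envTriv :=
  ProjectiveResolution.ofExact L.resX (fun n => resMap n b h) L.resAug (fun _ => resX_projective)
    (resMap_comp_resMap b h)
    (ModuleCat.hom_ext <| LinearMap.ext fun f => envAug_resD b h f.1)
    (fun c => by
      obtain ⟨f, hf, e⟩ := exists_supported_zero (L := L) (algebraMap K L.Env c)
      exact ⟨⟨f, hf⟩, (congrArg L.envAug e).trans (AlgHom.commutes _ _)⟩)
    (fun f hf => by
      obtain ⟨y, hy, e⟩ := exists_resD_eq_zero b h f.2 hf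
      exact ⟨⟨y, hy⟩, Subtype.ext e⟩)
    (fun n f hf => by
      obtain ⟨y, hy, e⟩ := exists_resD_eq b h hK f.2 (congrArg Subtype.val hf)
      exact ⟨⟨y, hy⟩, Subtype.ext e⟩)

theorem resolution_d (hK : L.IsKoszul) (n : ℕ) :
    (resolution b h hK).complex.d (n + 1) n = resMap n b h :=
  ChainComplex.of_d_succ _ _ (resMap_comp_resMap b h) n

end Resolution

/-! ### Cochains with coefficients in a left module -/

section Cochains

variable (V : Type u) [AddCommGroup V] [Module K V] [Module L.Env V] [IsScalarTower K L.Env V]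

/-- The pairing `(v ⊗ α, f) ↦ f(α) v` of `V ⊗ 𝒜^!` with `Hom(𝒜^!_n, 𝔄)`. -/
def cochainHom (n : ℕ) : V ⊗[K] L.KDual →ₗ[K] (L.supported L.Env L.Env n →ₗ[L.Env] V) :=
  TensorProduct.lift <| LinearMap.mk₂ K
    (fun v α => LinearMap.toSpanSingleton L.Env V v ∘ₗ L.evalAt n α)
    (fun _ _ _ => LinearMap.ext fun _ => smul_add _ _ _)
    (fun _ _ _ => LinearMap.ext fun _ => smul_comm _ _ _)
    (fun v α β => LinearMap.ext fun f =>
      (congrArg (· • v) (map_add f.1 α β)).trans (add_smul _ _ _))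
    (fun c v α => LinearMap.ext fun f =>
      (congrArg (· • v) (map_smul f.1 c α)).trans (smul_assoc _ _ _))

variable {L V}

theorem cochainHom_tmul {n : ℕ} (v : V) (α : L.KDual) (f : L.supported L.Env L.Env n) :
    L.cochainHom V n (v ⊗ₜ α) f = f.1 α • v := rfl

theorem sum_cochainHom [FiniteDimensional K E] {n : ℕ} {x : V ⊗[K] L.KDual}
    (hx : x ∈ L.cochains V n) :
    ∑ i, L.cochainHom V n x (L.supportedBasis n i) ⊗ₜ[K] (L.dualPartBasis n i : L.KDual) = x := by
  obtain ⟨y, rfl⟩ := hx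
  induction y using TensorProduct.induction_on with
  | zero => simp
  | tmul v α =>
    simp only [LinearMap.lTensor_tmul, Submodule.subtype_apply, cochainHom_tmul,
      supportedBasis_apply, algebraMap_smul, TensorProduct.smul_tmul, ← TensorProduct.tmul_sum]
    congr 1
    have h := congrArg (degPart L.dualRel n).subtype ((L.dualPartBasis n).sum_repr α)
    simpa only [map_sum, map_smul, Submodule.subtype_apply, Module.Basis.coord_apply] using h
  | add x y hx hy =>
    simp only [map_add, LinearMap.add_apply, TensorProduct.add_tmul, Finset.sum_add_distrib, hx, hy]

omit [Module L.Env V] [IsScalarTower K L.Env V] in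
theorem sum_tmul_mem_cochains [FiniteDimensional K E] {n : ℕ}
    (a : Fin (Module.finrank K (degPart L.dualRel n)) → V) :
    ∑ i, a i ⊗ₜ[K] (L.dualPartBasis n i : L.KDual) ∈ L.cochains V n :=
  Submodule.sum_mem _ fun i _ => ⟨a i ⊗ₜ L.dualPartBasis n i, rfl⟩

theorem cochainHom_cochainD {ι : Type*} [Fintype ι] (b : Module.Basis ι K E)
    {δ : L.KDual →ₗ[K] L.KDual}
    {n : ℕ} (x : V ⊗[K] L.KDual) (f : L.supported L.Env L.Env (n + 1))
    (hf : L.resD b δ f.1 ∈ L.supported L.Env L.Env n) :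
    L.cochainHom V (n + 1) (L.cochainD b δ V x) f = L.cochainHom V n x ⟨_, hf⟩ := by
  induction x using TensorProduct.induction_on with
  | zero => simp
  | tmul v α =>
    rw [cochainD_tmul, cochainHom_tmul, resD_apply, add_smul, Finset.sum_smul]
    simp only [map_add, map_sum, LinearMap.add_apply, LinearMap.sum_apply, cochainHom_tmul,
      mul_smul]
  | add x y hx hy => simp only [map_add, LinearMap.add_apply, hx, hy]

theorem cochainD_mem {ι : Type*} [Fintype ι] (b : Module.Basis ι K E)
    {δ : L.KDual →ₗ[K] L.KDual}
    (hδ : ∀ n, (degPart L.dualRel n).map δ ≤ degPart L.dualRel (n + 1)) {n : ℕ}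
    {x : V ⊗[K] L.KDual} (hx : x ∈ L.cochains V n) :
    L.cochainD b δ V x ∈ L.cochains V (n + 1) := by
  have htmul : ∀ (v : V) {α : L.KDual}, α ∈ degPart L.dualRel (n + 1) →
      v ⊗ₜ[K] α ∈ L.cochains V (n + 1) := fun v α hα => ⟨v ⊗ₜ ⟨α, hα⟩, rfl⟩
  obtain ⟨y, rfl⟩ := hx
  induction y using TensorProduct.induction_on with
  | zero => simp
  | tmul v α =>
    rw [LinearMap.lTensor_tmul, cochainD_tmul]
    exact add_mem (Submodule.sum_mem _ fun i _ => htmul _ (mulGen_mem _ α.2))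
      (htmul _ (hδ n ⟨_, α.2, rfl⟩))
  | add x y hx hy => rw [map_add, map_add]; exact add_mem hx hy

theorem cochainHom_naturality {V' : Type u} [AddCommGroup V'] [Module K V'] [Module L.Env V']
    [IsScalarTower K L.Env V'] (g : V →ₗ[L.Env] V') {n : ℕ} (x : V ⊗[K] L.KDual) :
    L.cochainHom V' n ((g.restrictScalars K).rTensor L.KDual x) = g ∘ₗ L.cochainHom V n x := by
  induction x using TensorProduct.induction_on with
  | zero => simp
  | tmul v α =>
    exact LinearMap.ext fun f => (map_smul g (f.1 α) v).symm
  | add x y hx hy => simp only [map_add, LinearMap.comp_add, hx, hy]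

end Cochains

end Prealgebra

namespace Prealgebra

open Presented AugAlg

variable {K E : Type u} [Field K] [AddCommGroup E] [Module K E] {L : Prealgebra K E}

/-! ### Extensions of the trivial module -/

section Ext

variable (V : Type u) [AddCommGroup V] [Module K V] [Module L.Env V] [IsScalarTower K L.Env V]

/-- The identification of `V ⊗ 𝒜^!_n` with the morphisms `Hom(𝒜^!_n, 𝔄) → V`. -/
def cochainMor (n : ℕ) :=
  ModuleCat.linearFamily (K := K) (X := L.resX n) (Y := ModuleCat.of L.Env V)
    (fun x : L.cochains V n => L.cochainHom V n x)
    (fun x y f => LinearMap.congr_fun (map_add (L.cochainHom V n) x.1 y.1) f)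
    (fun c x f => (LinearMap.congr_fun (map_smul (L.cochainHom V n) c x.1) f).trans
      (algebraMap_smul L.Env c (L.cochainHom V n x f)).symm)

variable [FiniteDimensional K E]

theorem cochainMor_bijective (n : ℕ) : Function.Bijective (cochainMor (L := L) V n) := by
  constructor
  · intro x y e
    refine Subtype.ext ?_
    have e' : L.cochainHom V n x = L.cochainHom V n y := congrArg ModuleCat.Hom.hom e
    rw [← sum_cochainHom x.2, ← sum_cochainHom y.2, e']
  · intro F
    classical
    refine ⟨⟨_, sum_tmul_mem_cochains fun i => F.hom (L.supportedBasis n i)⟩,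
      ModuleCat.hom_ext ((L.supportedBasis n).ext fun j => ?_)⟩
    change L.cochainHom V n (∑ i, F.hom (L.supportedBasis n i) ⊗ₜ[K] _) _ = _
    simp only [map_sum, LinearMap.sum_apply, cochainHom_tmul, supportedBasis_apply,
      Module.Basis.coord_apply, Module.Basis.repr_self, Finsupp.single_apply, algebraMap_smul,
      ite_smul, one_smul, zero_smul, Finset.sum_ite_eq', Finset.mem_univ, if_true]

variable {ι : Type*} [Fintype ι] (b : Module.Basis ι K E) (h : L.HasPBW) (hK : L.IsKoszul)

theorem cochainMor_cochainD (n : ℕ) (z : L.cochains V n) :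
    cochainMor V (n + 1) ⟨L.cochainD b (differential h) V z,
      cochainD_mem b (differential_degree h) z.2⟩ =
      (resolution b h hK).complex.d (n + 1) n ≫ cochainMor V n z := by
  rw [resolution_d]
  exact ModuleCat.hom_ext (LinearMap.ext fun f => cochainHom_cochainD b z.1 f
    (resD_mem b (differential_degree h) f.2))

/-- The cohomology of `V ⊗ 𝒜^!` is `Ext(K, V)`. -/
def cohomEquivExt (n : ℕ) :
    L.Cohom b (differential h) V n ≃ₗ[K] Abelian.Ext L.envTriv (ModuleCat.of L.Env V) n :=
  (resolution b h hK).extEquiv (cochainMor V)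
    (fun _ _ hz => cochainD_mem b (differential_degree h) hz)
    (cochainMor_cochainD V b h hK) (cochainMor_bijective V) n

variable {V} {V' : Type u} [AddCommGroup V'] [Module K V'] [Module L.Env V']
    [IsScalarTower K L.Env V']

theorem cohomEquivExt_naturality (n : ℕ) (g : V →ₗ[L.Env] V')
    (z : cycles (L.cochainD b (differential h) V) (L.cochains V n))
    (z' : cycles (L.cochainD b (differential h) V') (L.cochains V' n))
    (e : (z' : V' ⊗[K] L.KDual) = (g.restrictScalars K).rTensor L.KDual z) :
    cohomEquivExt V' b h hK n (Cohom.cls L b _ V' n z') =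
      (cohomEquivExt V b h hK n (Cohom.cls L b _ V n z)).comp
        (Abelian.Ext.mk₀ (ModuleCat.ofHom g)) (add_zero n) := by
  refine (resolution b h hK).extEquiv_cls_comp (cochainMor V) _ _ (cochainMor_bijective V)
    (cochainMor V') _ _ (cochainMor_bijective V') n _ z z' (ModuleCat.hom_ext ?_)
  change L.cochainHom V' n z' = g ∘ₗ L.cochainHom V n z
  rw [e, cochainHom_naturality]

end Ext

end Prealgebra

/-! ### Left derived functors in terms of a projective resolution -/

namespace CategoryTheory.ProjectiveResolution

variable {K A : Type u} [Field K] [Ring A] (F : ModuleCat.{u} A ⥤ ModuleCat.{u} K) [F.Additive]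
  {X : ModuleCat.{u} A} (R : ProjectiveResolution X)
  {M : Type u} [AddCommGroup M] [Module K M] {d : M →ₗ[K] M} {P : ℕ → Submodule K M}
  (ψ : ∀ n, P n →ₗ[K] F.obj (R.complex.X n)) (h0 : ∀ z ∈ P 0, d z = 0)
  (hd : ∀ n, ∀ z ∈ P (n + 1), d z ∈ P n)
  (hψ : ∀ n (z : P (n + 1)),
    ψ n ⟨d z, hd n z z.2⟩ = (F.map (R.complex.d (n + 1) n)).hom (ψ (n + 1) z))
  (hbij : ∀ n, Function.Bijective (ψ n))

/-- When `ψ` is an isomorphism from a complex `(M, d)` to `F(R)`, where `R` is a projective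
resolution of `X`, the homology of `(M, d)` is the value at `X` of the left derived functors of
`F`. -/
def leftDerivedEquiv (n : ℕ) : Homol d (P n) (P (n + 1)) ≃ₗ[K] (F.leftDerived n).obj X :=
  (ChainComplex.homologyEquiv ((F.mapHomologicalComplex _).obj R.complex) ψ h0 hd hψ hbij n).trans
    (R.isoLeftDerivedObj F n).symm.toLinearEquiv

variable {F} {F' : ModuleCat.{u} A ⥤ ModuleCat.{u} K} [F'.Additive] (τ : F ⟶ F')
  {M' : Type u} [AddCommGroup M'] [Module K M'] {d' : M' →ₗ[K] M'} {P' : ℕ → Submodule K M'}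
  (ψ' : ∀ n, P' n →ₗ[K] F'.obj (R.complex.X n)) (h0' : ∀ z ∈ P' 0, d' z = 0)
  (hd' : ∀ n, ∀ z ∈ P' (n + 1), d' z ∈ P' n)
  (hψ' : ∀ n (z : P' (n + 1)),
    ψ' n ⟨d' z, hd' n z z.2⟩ = (F'.map (R.complex.d (n + 1) n)).hom (ψ' (n + 1) z))
  (hbij' : ∀ n, Function.Bijective (ψ' n))

theorem leftDerivedEquiv_naturality (n : ℕ) (z : cycles d (P n)) (z' : cycles d' (P' n))
    (e : (τ.app (R.complex.X n)).hom (ψ n ⟨z, z.2.1⟩) = ψ' n ⟨z', z'.2.1⟩) :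
    leftDerivedEquiv F' R ψ' h0' hd' hψ' hbij' n (Homol.cls d' (P' n) _ z') =
      ((NatTrans.leftDerived τ n).app X).hom
        (leftDerivedEquiv F R ψ h0 hd hψ hbij n (Homol.cls d (P n) _ z)) := by
  have key := ChainComplex.homologyMap_homologyClass
    (G := (F.mapHomologicalComplex _).obj R.complex)
    ψ hd hψ (G' := (F'.mapHomologicalComplex _).obj R.complex) ψ' hd' hψ'
    ((NatTrans.mapHomologicalComplex τ _).app R.complex) n z z' e
  have h1 := congrArg ModuleCat.Hom.hom (R.leftDerived_app_eq τ n)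
  have h2 := congrArg ModuleCat.Hom.hom (R.isoLeftDerivedObj F n).inv_hom_id
  rw [h1]
  refine Eq.symm (congrArg (R.isoLeftDerivedObj F' n).inv.hom (Eq.trans ?_ key))
  exact congrArg (HomologicalComplex.homologyMap
    ((NatTrans.mapHomologicalComplex τ _).app R.complex) n).hom (LinearMap.congr_fun h2 _)

end CategoryTheory.ProjectiveResolution

/-! ### Tensor products over a noncommutative algebra -/

namespace AugAlg

variable {K A : Type u} [Field K] [Ring A] [Algebra K A]
variable {W : Type u} [AddCommGroup W] [Module K W] [Module Aᵐᵒᵖ W] [IsScalarTower K Aᵐᵒᵖ W]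
variable {W' : Type u} [AddCommGroup W'] [Module K W'] [Module Aᵐᵒᵖ W'] [IsScalarTower K Aᵐᵒᵖ W']
variable {X Y : ModuleCat.{u} A}

variable (K) in
/-- The class of `w ⊗ x` in `W ⊗_A X`. -/
def tmk (w : W) (x : X) : (tensorFunctor K A W).obj X :=
  Submodule.Quotient.mk (w ⊗ₜ[ℤ] x)

theorem tmk_add_left (w w' : W) (x : X) : tmk K (w + w') x = tmk K w x + tmk K w' x :=
  congrArg Submodule.Quotient.mk (TensorProduct.add_tmul w w' x)

theorem tmk_smul (c : K) (w : W) (x : X) : tmk K (c • w) x = c • tmk K w x := rfl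

theorem tmk_sum {ι : Type*} (s : Finset ι) (w : W) (x : ι → X) :
    tmk K w (∑ i ∈ s, x i) = ∑ i ∈ s, tmk K w (x i) :=
  (congrArg Submodule.Quotient.mk (TensorProduct.tmul_sum w s x)).trans
    (map_sum (Submodule.mkQ (balanced K A W X)) _ _)

theorem tmk_op_smul (a : A) (w : W) (x : X) :
    tmk K (MulOpposite.op a • w) x = tmk K w (a • x) :=
  (Submodule.Quotient.eq _).2 (Submodule.subset_span ⟨w, a, x, rfl⟩)

theorem tensor_hom_ext {V : Type u} [AddCommGroup V] [Module K V]
    {p q : (tensorFunctor K A W).obj X →ₗ[K] V} (h : ∀ w x, p (tmk K w x) = q (tmk K w x)) :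
    p = q :=
  balanced_hom_ext h

variable (K W) in
/-- The map `W ⊗_A X → W`, `w ⊗ x ↦ w φ(x)` given by a linear form `φ` on `X`. -/
def tensorEval (φ : X →ₗ[A] A) : (tensorFunctor K A W).obj X →ₗ[K] W :=
  Submodule.liftQ (balanced K A W X) (TensorProduct.AlgebraTensorModule.lift
    { toFun := fun w =>
        { toFun := fun x => MulOpposite.op (φ x) • w
          map_add' := fun x y => by rw [map_add, MulOpposite.op_add, add_smul]
          map_smul' := fun c x => by rw [map_zsmul, MulOpposite.op_smul, smul_assoc]; rfl }
      map_add' := fun w w' => LinearMap.ext fun x => smul_add (MulOpposite.op (φ x)) w w'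
      map_smul' := fun c w => LinearMap.ext fun x => smul_comm (MulOpposite.op (φ x)) c w })
    (Submodule.span_le.2 (by
      rintro _ ⟨w, a, x, rfl⟩
      refine LinearMap.mem_ker.2 ((map_sub _ _ _).trans (sub_eq_zero.2 ?_))
      change MulOpposite.op (φ x) • MulOpposite.op a • w = MulOpposite.op (φ (a • x)) • w
      rw [map_smul, smul_eq_mul, MulOpposite.op_mul, mul_smul]))

theorem tensorEval_tmk (φ : X →ₗ[A] A) (w : W) (x : X) :
    tensorEval K W φ (tmk K w x) = MulOpposite.op (φ x) • w := rfl

theorem tensorEval_map (φ : Y →ₗ[A] A) (f : X ⟶ Y) (y : (tensorFunctor K A W).obj X) :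
    tensorEval K W φ (((tensorFunctor K A W).map f).hom y) =
      tensorEval K W (φ ∘ₗ f.hom) y :=
  LinearMap.congr_fun (f := tensorEval K W φ ∘ₗ ((tensorFunctor K A W).map f).hom)
    (g := tensorEval K W (φ ∘ₗ f.hom)) (tensor_hom_ext fun _ _ => rfl) y

variable {ι : Type*} [Fintype ι] (e : Module.Basis ι A X)

variable (K W) in
/-- The map `W^ι → W ⊗_A X` given by a basis of `X` indexed by `ι`. -/
def tensorOfBasis : (ι → W) →ₗ[K] (tensorFunctor K A W).obj X where
  toFun a := ∑ i, tmk K (a i) (e i)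
  map_add' a a' := by simp only [Pi.add_apply, tmk_add_left, Finset.sum_add_distrib]
  map_smul' c a := by simp only [Pi.smul_apply, tmk_smul, Finset.smul_sum, RingHom.id_apply]

theorem tensorOfBasis_apply (a : ι → W) : tensorOfBasis K W e a = ∑ i, tmk K (a i) (e i) := rfl

theorem tensorEval_tensorOfBasis (φ : X →ₗ[A] A) (a : ι → W) :
    tensorEval K W φ (tensorOfBasis K W e a) = ∑ i, MulOpposite.op (φ (e i)) • a i := by
  rw [tensorOfBasis_apply, map_sum]
  rfl

theorem tensorOfBasis_tensorEval (y : (tensorFunctor K A W).obj X) :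
    tensorOfBasis K W e (fun i => tensorEval K W (e.coord i) y) = y := by
  refine LinearMap.congr_fun (f := tensorOfBasis K W e ∘ₗ
    LinearMap.pi fun i => tensorEval K W (e.coord i)) (g := LinearMap.id)
    (tensor_hom_ext fun w x => ?_) y
  change ∑ i, tmk K (tensorEval K W (e.coord i) (tmk K w x)) (e i) = tmk K w x
  simp only [tensorEval_tmk, tmk_op_smul, ← tmk_sum, Module.Basis.coord_apply, e.sum_repr]

end AugAlg

namespace Prealgebra

open Presented AugAlg

variable {K E : Type u} [Field K] [AddCommGroup E] [Module K E] {L : Prealgebra K E}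

/-! ### Chains with coefficients in a right module -/

section Chains

variable (W : Type u) [AddCommGroup W] [Module K W] [Module L.Envᵐᵒᵖ W]
  [IsScalarTower K L.Envᵐᵒᵖ W]

section

variable {W} {ι : Type*} [Fintype ι] (b : Module.Basis ι K E)

theorem toHom_chainD (δ : L.KDual →ₗ[K] L.KDual) (x : W ⊗[K] Module.Dual K L.KDual) :
    L.toHom W (L.chainD b δ W x) = L.koszulOp b
      (fun x => Algebra.lsmul K K W (MulOpposite.op (gen L.envRel x))) (L.toHom W x) +
        L.toHom W x ∘ₗ δ := by
  rw [chainD, LinearMap.add_apply, map_add, toHom_contract]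
  congr 1
  induction x using TensorProduct.induction_on with
  | zero => simp
  | tmul w ξ => rfl
  | add x y hx hy => simp only [map_add, LinearMap.add_comp, hx, hy]

variable [FiniteDimensional K E] {δ : L.KDual →ₗ[K] L.KDual}
  (hδ : ∀ n, (degPart L.dualRel n).map δ ≤ degPart L.dualRel (n + 1))

include hδ

theorem chainD_mem {n : ℕ} {x : W ⊗[K] Module.Dual K L.KDual} (hx : x ∈ L.chains W (n + 1)) :
    L.chainD b δ W x ∈ L.chains W n := by
  rw [mem_chains_iff] at hx ⊢
  rw [toHom_chainD]
  exact add_mem (koszulOp_mem b _ hx) (comp_mem_of_degree hδ hx)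

theorem chainD_eq_zero {x : W ⊗[K] Module.Dual K L.KDual} (hx : x ∈ L.chains W 0) :
    L.chainD b δ W x = 0 := by
  rw [mem_chains_iff] at hx
  refine L.toHom_injective ?_
  rw [toHom_chainD, koszulOp_eq_zero b _ hx, zero_add, map_zero]
  exact ext_degPart fun n α hα => hx (n + 1) n.succ_ne_zero _ (hδ n ⟨α, hα, rfl⟩)

end

variable [FiniteDimensional K E]

/-- The identification of `W ⊗ (𝒜^!_n)^*` with `W ⊗_𝔄 Hom(𝒜^!_n, 𝔄)`. -/
def chainToTensor (n : ℕ) : L.chains W n →ₗ[K] (tensorFunctor K L.Env W).obj (L.resX n) :=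
  tensorOfBasis K W (X := L.resX n) (L.supportedBasis n) ∘ₗ
    LinearMap.pi (fun i => LinearMap.applyₗ (L.dualPartBasis n i : L.KDual)) ∘ₗ
      L.toHom W ∘ₗ (L.chains W n).subtype

variable {W} {n : ℕ}

theorem chainToTensor_apply (x : L.chains W n) :
    chainToTensor W n x = tensorOfBasis K W (X := L.resX n) (L.supportedBasis n)
      (fun i => L.toHom W x (L.dualPartBasis n i)) := rfl

theorem tensorEval_chainToTensor (x : L.chains W n) {α : L.KDual} (hα : α ∈ degPart L.dualRel n) :
    tensorEval K W (X := L.resX n) (L.evalAt n α) (chainToTensor W n x) = L.toHom W x α := by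
  rw [chainToTensor_apply, tensorEval_tensorOfBasis]
  lift α to degPart L.dualRel n using hα
  have h := congrArg (L.toHom W x ∘ₗ (degPart L.dualRel n).subtype)
    ((L.dualPartBasis n).sum_repr α)
  refine Eq.trans (Finset.sum_congr rfl fun i _ => ?_) ((map_sum _ _ _).symm.trans h)
  change MulOpposite.op ((L.supportedBasis n i).1 α) • _ = _
  rw [supportedBasis_apply, map_smul, Module.Basis.coord_apply]
  exact algebraMap_smul L.Envᵐᵒᵖ ((L.dualPartBasis n).repr α i) _

theorem chainToTensor_bijective (n : ℕ) :
    Function.Bijective (chainToTensor (L := L) W n) := by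
  constructor
  · intro x y e
    refine Subtype.ext (L.toHom_injective
      (supported_ext (toHom_mem x.2) (toHom_mem y.2) fun α hα => ?_))
    rw [← tensorEval_chainToTensor x hα, e, tensorEval_chainToTensor y hα]
  · intro y
    obtain ⟨x, hx, e⟩ := exists_toHom_eq (L := L) (n := n) (comp_dualComp_mem (S := K)
      ((L.dualPartBasis n).constr K fun i =>
        tensorEval K W (X := L.resX n) (L.evalAt n (L.dualPartBasis n i)) y))
    refine ⟨⟨x, hx⟩, Eq.trans ?_ (tensorOfBasis_tensorEval (X := L.resX n) (L.supportedBasis n) y)⟩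
    rw [chainToTensor_apply]
    refine congrArg _ (funext fun i => ?_)
    change L.toHom W x _ = _
    rw [e, LinearMap.comp_apply, dualComp_of_mem, Module.Basis.constr_basis]
    rfl

variable {ι : Type*} [Fintype ι] (b : Module.Basis ι K E) (h : L.HasPBW) (hK : L.IsKoszul)

/-- The differential of `W ⊗_𝔄 Hom(𝒜^!_n, 𝔄)` in terms of the evaluations, in which it takes the
form of `δ_W`. -/
theorem tensorEval_resMap (α : L.KDual) (y : (tensorFunctor K L.Env W).obj (L.resX (n + 1))) :
    tensorEval K W (X := L.resX n) (L.evalAt n α)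
      (((tensorFunctor K L.Env W).map (resMap n b h)).hom y) =
      ∑ i, MulOpposite.op (gen L.envRel (b i)) •
        tensorEval K W (X := L.resX (n + 1)) (L.evalAt (n + 1) (L.mulGen (b.coord i) α)) y +
      tensorEval K W (X := L.resX (n + 1)) (L.evalAt (n + 1) (differential h α)) y := by
  rw [tensorEval_map]
  refine LinearMap.congr_fun
    (g := (∑ i, Algebra.lsmul K K W (MulOpposite.op (gen L.envRel (b i))) ∘ₗ
        tensorEval K W (X := L.resX (n + 1)) (L.evalAt (n + 1) (L.mulGen (b.coord i) α))) +
      tensorEval K W (X := L.resX (n + 1)) (L.evalAt (n + 1) (differential h α)))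
    (tensor_hom_ext fun w f => ?_) y |>.trans ?_
  · rw [LinearMap.add_apply, LinearMap.sum_apply, tensorEval_tmk, tensorEval_tmk]
    change MulOpposite.op (L.resD b (differential h) f.1 α) • w = _
    rw [resD_apply, MulOpposite.op_add, add_smul, Finset.op_sum, Finset.sum_smul]
    congr 1
    refine Finset.sum_congr rfl fun i _ => ?_
    rw [MulOpposite.op_mul, mul_smul]
    rfl
  · rw [LinearMap.add_apply, LinearMap.sum_apply]
    rfl

theorem chainToTensor_chainD (n : ℕ) (z : L.chains W (n + 1)) :
    chainToTensor W n ⟨L.chainD b (differential h) W z,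
      chainD_mem b (differential_degree h) z.2⟩ =
      ((tensorFunctor K L.Env W).map ((resolution b h hK).complex.d (n + 1) n)).hom
        (chainToTensor W (n + 1) z) := by
  rw [resolution_d, chainToTensor_apply]
  refine Eq.trans (congrArg _ (funext fun i => ?_))
    (tensorOfBasis_tensorEval (X := L.resX n) (L.supportedBasis n) _)
  refine Eq.trans ?_ (tensorEval_resMap b h (L.dualPartBasis n i : L.KDual) _).symm
  have hi := (L.dualPartBasis n i).2
  simp only [tensorEval_chainToTensor z (mulGen_mem _ hi),
    tensorEval_chainToTensor z (differential_mem h hi), toHom_chainD]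
  rw [LinearMap.add_apply, koszulOp_apply]
  rfl

variable (W) in
/-- The homology of `W ⊗ (𝒜^!)^*` is `Tor(W, K)`. -/
def homlgEquivTor (n : ℕ) :
    L.Homlg b (differential h) W n ≃ₗ[K] AugAlg.Tor W L.envAug n :=
  ProjectiveResolution.leftDerivedEquiv (tensorFunctor K L.Env W) (resolution b h hK)
    (chainToTensor W) (fun _ hz => chainD_eq_zero b (differential_degree h) hz)
    (fun _ _ hz => chainD_mem b (differential_degree h) hz)
    (chainToTensor_chainD b h hK) chainToTensor_bijective n

variable {W' : Type u} [AddCommGroup W'] [Module K W'] [Module L.Envᵐᵒᵖ W']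
  [IsScalarTower K L.Envᵐᵒᵖ W']

theorem tensorNat_chainToTensor {n : ℕ} (g : W →ₗ[L.Envᵐᵒᵖ] W') (z : L.chains W n)
    (z' : L.chains W' n) (e : (z' : W' ⊗[K] Module.Dual K L.KDual) =
      (g.restrictScalars K).rTensor (Module.Dual K L.KDual) z) :
    ((tensorNat g).app (L.resX n)).hom (chainToTensor W n z) = chainToTensor W' n z' := by
  have h1 : ∀ x, L.toHom W' ((g.restrictScalars K).rTensor (Module.Dual K L.KDual) x) =
      g.restrictScalars K ∘ₗ L.toHom W x := by
    intro x
    induction x using TensorProduct.induction_on with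
    | zero => simp
    | tmul w ξ => exact LinearMap.ext fun α => (map_smul (g.restrictScalars K) (ξ α) w).symm
    | add x y hx hy => simp only [map_add, LinearMap.comp_add, hx, hy]
  rw [chainToTensor_apply, chainToTensor_apply, tensorOfBasis_apply, tensorOfBasis_apply, map_sum,
    e, h1]
  rfl

theorem homlgEquivTor_naturality (n : ℕ) (g : W →ₗ[L.Envᵐᵒᵖ] W')
    (z : cycles (L.chainD b (differential h) W) (L.chains W n))
    (z' : cycles (L.chainD b (differential h) W') (L.chains W' n))
    (e : (z' : W' ⊗[K] Module.Dual K L.KDual) =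
      (g.restrictScalars K).rTensor (Module.Dual K L.KDual) z) :
    homlgEquivTor W' b h hK n (Homlg.cls L b _ W' n z') =
      AugAlg.Tor.map L.envAug n g (homlgEquivTor W b h hK n (Homlg.cls L b _ W n z)) :=
  ProjectiveResolution.leftDerivedEquiv_naturality (resolution b h hK) (chainToTensor W) _ _
    (chainToTensor_chainD b h hK) chainToTensor_bijective (tensorNat g) (chainToTensor W')
    _ _ (chainToTensor_chainD b h hK) chainToTensor_bijective n z z'
    (tensorNat_chainToTensor g ⟨z, z.2.1⟩ ⟨z', z'.2.1⟩ e)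

end Chains

end Prealgebra

end

theorem mainTheorem3 {K E : Type u} [Field K] [AddCommGroup E] [Module K E]
    [FiniteDimensional K E] (L : Prealgebra K E) (hL : L.IsLie)
    {ι : Type*} [Fintype ι] (b : Module.Basis ι K E) :
    ∃ δ : L.KDual →ₗ[K] L.KDual,
      -- the differential of the Koszul dual exists, is unique and squares to zero
      (L.IsDualDifferential δ ∧ (∀ δ', L.IsDualDifferential δ' → δ' = δ) ∧ δ ∘ₗ δ = 0) ∧
      -- `(V ⊗ 𝒜^!, δ_V)` is a cochain complex
      (∀ (V : Type u) [AddCommGroup V] [Module K V] [Module L.Env V] [IsScalarTower K L.Env V],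
        L.cochainD b δ V ∘ₗ L.cochainD b δ V = 0 ∧
        ∀ n, (L.cochains V n).map (L.cochainD b δ V) ≤ L.cochains V (n + 1)) ∧
      -- its cohomology is `Ext^n(K, V)`, naturally in `V`
      (∀ n : ℕ, ∃ e : ∀ (V : Type u) [AddCommGroup V] [Module K V] [Module L.Env V]
            [IsScalarTower K L.Env V],
          L.Cohom b δ V n ≃ₗ[K] Abelian.Ext L.envTriv (ModuleCat.of L.Env V) n,
        ∀ (V V' : Type u) [AddCommGroup V] [Module K V] [Module L.Env V] [IsScalarTower K L.Env V]
          [AddCommGroup V'] [Module K V'] [Module L.Env V'] [IsScalarTower K L.Env V']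
          (f : V →ₗ[L.Env] V')
          (z : cycles (L.cochainD b δ V) (L.cochains V n))
          (z' : cycles (L.cochainD b δ V') (L.cochains V' n)),
          (z' : V' ⊗[K] L.KDual) = (f.restrictScalars K).rTensor L.KDual z →
          e V' (Prealgebra.Cohom.cls L b δ V' n z') =
            (e V (Prealgebra.Cohom.cls L b δ V n z)).comp
              (Abelian.Ext.mk₀ (ModuleCat.ofHom f)) (add_zero n)) ∧
      -- `(W ⊗ 𝒜^{!*}, δ_W)` is a chain complex
      (∀ (W : Type u) [AddCommGroup W] [Module K W] [Module L.Envᵐᵒᵖ W]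
          [IsScalarTower K L.Envᵐᵒᵖ W],
        L.chainD b δ W ∘ₗ L.chainD b δ W = 0 ∧
        (L.chains W 0).map (L.chainD b δ W) = ⊥ ∧
        ∀ n, (L.chains W (n + 1)).map (L.chainD b δ W) ≤ L.chains W n) ∧
      -- its homology is `Tor_n(W, K)`, naturally in `W`
      (∀ n : ℕ, ∃ e : ∀ (W : Type u) [AddCommGroup W] [Module K W] [Module L.Envᵐᵒᵖ W]
            [IsScalarTower K L.Envᵐᵒᵖ W],
          L.Homlg b δ W n ≃ₗ[K] AugAlg.Tor W L.envAug n,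
        ∀ (W W' : Type u) [AddCommGroup W] [Module K W] [Module L.Envᵐᵒᵖ W]
          [IsScalarTower K L.Envᵐᵒᵖ W]
          [AddCommGroup W'] [Module K W'] [Module L.Envᵐᵒᵖ W'] [IsScalarTower K L.Envᵐᵒᵖ W']
          (g : W →ₗ[L.Envᵐᵒᵖ] W')
          (z : cycles (L.chainD b δ W) (L.chains W n))
          (z' : cycles (L.chainD b δ W') (L.chains W' n)),
          (z' : W' ⊗[K] Module.Dual K L.KDual) =
            (g.restrictScalars K).rTensor (Module.Dual K L.KDual) z →
          e W' (Prealgebra.Homlg.cls L b δ W' n z') =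
            AugAlg.Tor.map L.envAug n g (e W (Prealgebra.Homlg.cls L b δ W n z))) := by
  have h := hL.pbw
  refine ⟨Prealgebra.differential h, ⟨Prealgebra.isDualDifferential h,
      fun δ' hδ' => hδ'.eq_differential h,
      LinearMap.ext (Prealgebra.differential_differential h)⟩,
    fun V _ _ _ _ => ⟨Prealgebra.cochainD_cochainD b h V, ?_⟩,
    fun n => ⟨fun V _ _ _ _ => Prealgebra.cohomEquivExt V b h hL.koszul n, ?_⟩,
    fun W _ _ _ _ => ⟨Prealgebra.chainD_chainD b h W, ?_, ?_⟩,
    fun n => ⟨fun W _ _ _ _ => Prealgebra.homlgEquivTor W b h hL.koszul n, ?_⟩⟩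
  · rintro n _ ⟨x, hx, rfl⟩
    exact Prealgebra.cochainD_mem b (Prealgebra.differential_degree h) hx
  · intro V V' _ _ _ _ _ _ _ _ f z z' e
    exact Prealgebra.cohomEquivExt_naturality b h hL.koszul n f z z' e
  · rw [eq_bot_iff]
    rintro _ ⟨x, hx, rfl⟩
    exact Prealgebra.chainD_eq_zero b (Prealgebra.differential_degree h) hx
  · rintro n _ ⟨x, hx, rfl⟩
    exact Prealgebra.chainD_mem b (Prealgebra.differential_degree h) hx
  · intro W W' _ _ _ _ _ _ _ _ g z z' e
    exact Prealgebra.homlgEquivTor_naturality b h hL.koszul n g z z' e
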